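/- Let $G$ be a finite group and let $p$ be a prime dividing $|G|$. Let $k$ be a commutative ring. A short exact sequence of $kG$-modules is called $k$-split if it splits over $k$; a $kG$-module $P$ is weakly projective if every morphism $P\to N$ lifts along every epimorphism $M\to N$ occurring in a $k$-split exact sequence $0\to L\to M\to N\to 0$. The stable module category $\mathsf{StMod}(kG)$ has all $kG$-modules as objects and the morphisms $\operatorname{Hom}_{kG}(M,N)/\operatorname{PHom}_{kG}(M,N)$, where $\operatorname{PHom}_{kG}(M,N)$ consists of the morphisms that factor through a weakly projective module; its exact triangles are those induced by $k$-split exact sequences. Let $\mathsf{stmod}(kG)$ be the full subcategory of the objects isomorphic in $\mathsf{StMod}(kG)$ to a finitely presented $kG$-module. It is a tensor triangulated category under $\otimes_k$ with diagonal $G$-action. For $n\ge 1$ let $\mathsf D_n$ be the full subcategory of $\mathsf{stmod}(\mathbb ZG)$ whose objects are those isomorphic in $\mathsf{StMod}(\mathbb ZG)$ to a $\mathbb ZG$-module annihilated by $p^n$. Then: 1. Each $\mathsf D_n$ ($n\ge 1$) is a thick tensor ideal of $\mathsf{stmod}(\mathbb ZG)$, and the chain is strictly increasing: $\mathsf D_1\subsetneq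 \mathsf D_2\subsetneq \mathsf D_3\subsetneq\cdots\subseteq\mathsf{stmod}(\mathbb ZG)$. 2. The trivial module $\mathbb Z$, an object of $\mathsf{stmod}(\mathbb ZG)$, lies in no $\mathsf D_n$; and $\bigcup_{n\ge 1}\mathsf D_n$ is a proper thick subcategory of $\mathsf{stmod}(\mathbb ZG)$. 3. Thick tensor ideals of $\mathsf{stmod}(\mathbb ZG)$ are not classified by cohomological support, as they are over a field. Precisely, let $\operatorname{Ext}^*_{G,1}$ denote relative cohomology (computed by relative projective resolutions: resolutions by weakly projective modules whose augmented complex is $k$-split exact), let $H^*(G,k)=\operatorname{Ext}^*_{G,1}(k,k)$, acting on $\operatorname{Ext}^*_{G,1}(M,M)$ through $-\otimes_k M$, let $\mathcal V_G$ be the set of homogeneous prime ideals of $H^*(G,k)$ not containing $H^{\ge 1}(G,k)$, and let $\mathcal V_G(M)=\{\mathfrak p\in\mathcal V_G \mid \operatorname{Ext}^*_{G,1}(M,M)_{\mathfrak p}\neq 0\}$ for a finitely presented $kG$-module $M$. For $k=\mathbb Z$, where $\mathbb Z/p^n$ carries the trivial action: $\mathbb Z/p^n$ is not in the thick tensor ideal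 of $\mathsf{stmod}(\mathbb ZG)$ generated by $\mathbb Z/p$ when $n>1$, but $\mathcal V_G(\mathbb Z/p^n)=\mathcal V_G(\mathbb Z/p)$ for all $n\ge 1$. Moreover, the assignment $\mathsf C\mapsto\bigcup_{M\in\mathsf C}\mathcal V_G(M)$ (the union over the finitely presented $M$ in $\mathsf C$), from thick tensor ideals of $\mathsf{stmod}(\mathbb ZG)$ to specialisation closed subsets of $\mathcal V_G$, is not injective, and hence not bijective. -/

import Mathlib

open CategoryTheory

universe u

noncomputable section

namespace StableRep

section Stable

variable (k : Type) [CommRing k] (G : Type u) [Group G]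

/-- A `kG`-module: a `k`-module with a linear action of `G`. The category of these is
equivalent to `ModuleCat k[G]` (`Rep.equivalenceModuleMonoidAlgebra`). -/
abbrev Mod := Rep.{0} k G

variable {k G}

/-- A short exact sequence of `kG`-modules that is split over `k`. -/
def IsKSplitExact (S : ShortComplex (Mod k G)) : Prop :=
  Nonempty (S.map (forget₂ (Mod k G) (ModuleCat.{0} k))).Splitting

/-- `P` is weakly projective: maps out of `P` lift along `k`-split epimorphisms. -/
def IsWeaklyProjective (P : Mod k G) : Prop :=
  ∀ S : ShortComplex (Mod k G), IsKSplitExact S →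
    ∀ φ : P ⟶ S.X₃, ∃ ψ : P ⟶ S.X₂, ψ ≫ S.g = φ

/-- The morphisms in `PHom(M, N)`: those factoring through a weakly projective module. -/
def IsPHom {M N : Mod k G} (f : M ⟶ N) : Prop :=
  ∃ (P : Mod k G) (a : M ⟶ P) (b : P ⟶ N), IsWeaklyProjective P ∧ a ≫ b = f

variable (k G) in
/-- The zero module. -/
abbrev zeroMod : Mod k G := Rep.trivial k G PUnit

lemma IsPHom.zero (M N : Mod k G) : IsPHom (0 : M ⟶ N) :=
  ⟨zeroMod k G, 0, 0, fun _ _ _ => ⟨0, by ext ⟨⟩; simp [Subsingleton.elim (PUnit.unit) (0 : zeroMod k G)]⟩, by simp⟩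

lemma IsPHom.neg {M N : Mod k G} {f : M ⟶ N} (hf : IsPHom f) : IsPHom (-f) := by
  obtain ⟨P, a, b, hP, rfl⟩ := hf
  exact ⟨P, -a, b, hP, by simp⟩

lemma IsPHom.add {M N : Mod k G} {f g : M ⟶ N} (hf : IsPHom f) (hg : IsPHom g) :
    IsPHom (f + g) := by
  obtain ⟨P, a, b, hP, rfl⟩ := hf
  obtain ⟨Q, c, d, hQ, rfl⟩ := hg
  refine ⟨P ⊞ Q, Limits.biprod.lift a c, Limits.biprod.desc b d, fun S hS φ => ?_, by simp⟩
  obtain ⟨ψ₁, h₁⟩ := hP S hS (Limits.biprod.inl ≫ φ)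
  obtain ⟨ψ₂, h₂⟩ := hQ S hS (Limits.biprod.inr ≫ φ)
  exact ⟨Limits.biprod.desc ψ₁ ψ₂, by
    apply Limits.biprod.hom_ext'
    · rw [Limits.biprod.inl_desc_assoc, h₁]
    · rw [Limits.biprod.inr_desc_assoc, h₂]⟩

lemma IsPHom.comp_left {L M N : Mod k G} (e : L ⟶ M) {f : M ⟶ N} (hf : IsPHom f) :
    IsPHom (e ≫ f) := by
  obtain ⟨P, a, b, hP, rfl⟩ := hf
  exact ⟨P, e ≫ a, b, hP, by simp⟩

lemma IsPHom.comp_right {L M N : Mod k G} {f : L ⟶ M} (e : M ⟶ N) (hf : IsPHom f) :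
    IsPHom (f ≫ e) := by
  obtain ⟨P, a, b, hP, rfl⟩ := hf
  exact ⟨P, a, b ≫ e, hP, by simp⟩

variable (k G)

/-- Two morphisms are identified when their difference lies in `PHom`. -/
def stableRel : HomRel (Mod k G) := fun _ _ f g => IsPHom (f - g)

instance : Congruence (stableRel k G) where
  equivalence :=
    { refl := fun f => by simpa [stableRel] using IsPHom.zero _ _
      symm := fun {f g} h => by
        have h' := IsPHom.neg h
        rwa [neg_sub] at h'
      trans := fun {f g e} h h' => by
        have h'' := IsPHom.add h h'
        rwa [sub_add_sub_cancel] at h'' }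
  comp_left := by
    intro _ _ _ f g g' h
    have h' := IsPHom.comp_left f h
    rwa [Preadditive.comp_sub] at h'
  comp_right := by
    intro _ _ _ f f' g h
    have h' := IsPHom.comp_right g h
    rwa [Preadditive.sub_comp] at h'

/-- The stable module category `StMod(kG)`: the objects are all `kG`-modules and the morphisms
are `Hom(M, N) / PHom(M, N)`. -/
abbrev StMod := CategoryTheory.Quotient (stableRel k G)

/-- The functor `Mod(kG) ⥤ StMod(kG)`. -/
abbrev toStMod : Mod k G ⥤ StMod k G := CategoryTheory.Quotient.functor (stableRel k G)

variable {k G} in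
/-- Finitely presented `kG`-modules. -/
def IsFinPres (M : Mod k G) : Prop :=
  Module.FinitePresentation (MonoidAlgebra k G) M.ρ.asModule

/-- `stmod(kG)`: the objects of `StMod(kG)` isomorphic there to a finitely presented module. -/
def stmod : ObjectProperty (StMod k G) := fun X =>
  ∃ M : Mod k G, IsFinPres M ∧ Nonempty (X ≅ (toStMod k G).obj M)

variable {k G}

/-- The thick subcategories of the triangulated category `stmod(kG)`, as full subcategories:
strictly full, containing zero, closed under exact triangles (two out of three) and under direct
summands (equivalently, retracts) in `stmod(kG)`. Every exact triangle is isomorphic in the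
stable category to one given by a `k`-split exact sequence, so for a class closed under
isomorphism it suffices to consider the latter; they include `0 → M → M↑G → ΣM → 0`, so that
closure under suspension and desuspension is covered. -/
structure IsThick (C : ObjectProperty (StMod k G)) : Prop where
  le_stmod : C ≤ stmod k G
  of_iso : ∀ X Y : StMod k G, Nonempty (X ≅ Y) → C X → C Y
  zero : C ((toStMod k G).obj (zeroMod k G))
  ext₁ : ∀ S : ShortComplex (Mod k G), IsKSplitExact S → stmod k G ((toStMod k G).obj S.X₁) →
    C ((toStMod k G).obj S.X₂) → C ((toStMod k G).obj S.X₃) → C ((toStMod k G).obj S.X₁)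
  ext₂ : ∀ S : ShortComplex (Mod k G), IsKSplitExact S → stmod k G ((toStMod k G).obj S.X₂) →
    C ((toStMod k G).obj S.X₁) → C ((toStMod k G).obj S.X₃) → C ((toStMod k G).obj S.X₂)
  ext₃ : ∀ S : ShortComplex (Mod k G), IsKSplitExact S → stmod k G ((toStMod k G).obj S.X₃) →
    C ((toStMod k G).obj S.X₁) → C ((toStMod k G).obj S.X₂) → C ((toStMod k G).obj S.X₃)
  retract : ∀ X Y : StMod k G, stmod k G X → Nonempty (Retract X Y) → C Y → C X

open MonoidalCategory in
/-- Thick tensor ideals of `stmod(kG)`; the tensor product is `⊗_k` with diagonal action. -/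
structure IsThickTensorIdeal (C : ObjectProperty (StMod k G)) : Prop extends IsThick C where
  tensor : ∀ M N : Mod k G, C ((toStMod k G).obj M) → stmod k G ((toStMod k G).obj N) →
    C ((toStMod k G).obj (M ⊗ N))

variable (k G) in
/-- The collection of thick tensor ideals of `stmod(kG)`. -/
def ThickTensorIdeal := {C : ObjectProperty (StMod k G) // IsThickTensorIdeal C}

/-- The thick tensor ideal of `stmod(kG)` generated by an object. -/
def thickTensorIdealGeneratedBy (X : StMod k G) : ObjectProperty (StMod k G) := fun Y =>
  ∀ C : ObjectProperty (StMod k G), IsThickTensorIdeal C → C X → C Y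

variable (G) in
/-- The objects of `stmod(ℤG)` isomorphic to a module annihilated by `p ^ n`. -/
def killedBy (p n : ℕ) : ObjectProperty (StMod ℤ G) := fun X =>
  stmod ℤ G X ∧ ∃ N : Mod ℤ G, (∀ x : N, ((p : ℤ) ^ n) • x = 0) ∧
    Nonempty (X ≅ (toStMod ℤ G).obj N)

end Stable

section Cohomology

variable {k : Type} [CommRing k] {G : Type u} [Group G]

/-- `Hom_{kG}(k[G^{n+1}] ⊗_k M, N)`, where `k[G^{n+1}]` is the degree `n` term of the standard
resolution of `k` and `k[G^{n+1}] ⊗_k M` has diagonal action: a homomorphism `φ` is recorded as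
`x ↦ φ(x ⊗ -)`. The modules `k[G^{n+1}] ⊗_k M` form a relative projective resolution of `M`. -/
def cochainSubmodule (M N : Mod k G) (n : ℕ) : Submodule k ((Fin (n + 1) → G) → (M.V →ₗ[k] N.V)) where
  carrier := {f | ∀ (h : G) (x : Fin (n + 1) → G),
    f (fun i => h * x i) ∘ₗ M.ρ h = N.ρ h ∘ₗ f x}
  add_mem' hf hg h x := by
    simp only [Pi.add_apply, LinearMap.add_comp, LinearMap.comp_add, hf h x, hg h x]
  zero_mem' h x := by simp
  smul_mem' c f hf h x := by
    simp only [Pi.smul_apply, LinearMap.smul_comp, LinearMap.comp_smul, hf h x]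

/-- The type of elements of `cochainSubmodule`. -/
def Cochain (M N : Mod k G) (n : ℕ) : Type u := cochainSubmodule M N n

instance (M N : Mod k G) (n : ℕ) : AddCommGroup (Cochain M N n) :=
  inferInstanceAs (AddCommGroup (cochainSubmodule M N n))

instance (M N : Mod k G) (n : ℕ) : Module k (Cochain M N n) :=
  inferInstanceAs (Module k (cochainSubmodule M N n))

section

variable {M N : Mod k G} {n : ℕ}

/-- The function underlying a cochain. -/
def Cochain.val (f : Cochain M N n) : (Fin (n + 1) → G) → (M.V →ₗ[k] N.V) :=
  Subtype.val (p := (· ∈ cochainSubmodule M N n)) f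

lemma Cochain.prop (f : Cochain M N n) (h : G) (x : Fin (n + 1) → G) :
    f.val (fun i => h * x i) ∘ₗ M.ρ h = N.ρ h ∘ₗ f.val x :=
  Subtype.property (p := (· ∈ cochainSubmodule M N n)) f h x

/-- Constructor for cochains. -/
def Cochain.mk (f : (Fin (n + 1) → G) → (M.V →ₗ[k] N.V)) (hf : ∀ (h : G) (x : Fin (n + 1) → G),
    f (fun i => h * x i) ∘ₗ M.ρ h = N.ρ h ∘ₗ f x) : Cochain M N n := ⟨f, hf⟩

@[simp] lemma Cochain.mk_val (f : (Fin (n + 1) → G) → (M.V →ₗ[k] N.V)) (hf) :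
    (Cochain.mk f hf : Cochain M N n).val = f := rfl

@[ext] lemma Cochain.ext {f g : Cochain M N n} (h : ∀ x m, f.val x m = g.val x m) : f = g :=
  Subtype.ext (p := (· ∈ cochainSubmodule M N n)) (funext fun x => LinearMap.ext (h x))

@[simp] lemma Cochain.add_val (f g : Cochain M N n) : (f + g).val = f.val + g.val := rfl

@[simp] lemma Cochain.smul_val (c : k) (f : Cochain M N n) : (c • f).val = c • f.val := rfl

end

/-- The differential of `Hom_{kG}(k[G^{•+1}] ⊗_k M, N)`. -/
def diff (M N : Mod k G) (n : ℕ) : Cochain M N n →ₗ[k] Cochain M N (n + 1) where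
  toFun f := .mk (fun x => ∑ i : Fin (n + 2), (-1 : k) ^ (i : ℕ) • f.val (fun j => x (i.succAbove j)))
    fun h x => by
      have hf := fun i : Fin (n + 2) => f.prop h (fun j => x (i.succAbove j))
      ext m
      simp only [LinearMap.comp_apply, LinearMap.sum_apply, LinearMap.smul_apply, map_sum,
        map_smul]
      exact Finset.sum_congr rfl fun i _ => congrArg _ (LinearMap.congr_fun (hf i) m)
  map_add' f g := by
    ext x m
    simp [Finset.sum_add_distrib]
  map_smul' c f := by
    ext x m
    simp [Finset.smul_sum, smul_comm c]

/-- The `n`-cocycles. -/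
def cocycles (M N : Mod k G) (n : ℕ) : Submodule k (Cochain M N n) := LinearMap.ker (diff M N n)

/-- The `n`-coboundaries. -/
def coboundaries (M N : Mod k G) : ∀ n : ℕ, Submodule k (Cochain M N n)
  | 0 => ⊥
  | n + 1 => LinearMap.range (diff M N n)

/-- The relative extension group `Ext^n_{G,1}(M, N)`. -/
abbrev RelExt (M N : Mod k G) (n : ℕ) : Type u :=
  cocycles M N n ⧸ (coboundaries M N n).comap (cocycles M N n).subtype

/-- The composition product on cochains (Alexander-Whitney). -/
def cup {L M N : Mod k G} {a b n : ℕ} (h : a + b = n) :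
    Cochain M N a →ₗ[k] Cochain L M b →ₗ[k] Cochain L N n :=
  LinearMap.mk₂ k
    (fun f g => .mk (fun x => f.val (fun i => x ⟨i, by omega⟩) ∘ₗ g.val (fun j => x ⟨a + j, by omega⟩))
      fun s x => by
        have hf := f.prop s (fun i => x ⟨i, by omega⟩)
        have hg := g.prop s (fun j => x ⟨a + j, by omega⟩)
        rw [LinearMap.comp_assoc, hg, ← LinearMap.comp_assoc, hf, LinearMap.comp_assoc])
    (fun f f' g => by ext x m; simp)
    (fun c f g => by ext x m; simp)
    (fun f g g' => by ext x m; simp)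
    (fun c f g => by ext x m; simp)

lemma cup_apply {L M N : Mod k G} {a b n : ℕ} (h : a + b = n) (f : Cochain M N a)
    (g : Cochain L M b) (x : Fin (n + 1) → G) :
    (cup h f g).val x = f.val (fun i => x ⟨i, by omega⟩) ∘ₗ g.val (fun j => x ⟨a + j, by omega⟩) := rfl

lemma diff_apply {M N : Mod k G} {n : ℕ} (f : Cochain M N n) (x : Fin (n + 2) → G) :
    (diff M N n f).val x =
      ∑ i : Fin (n + 2), (-1 : k) ^ (i : ℕ) • f.val (fun j => x (i.succAbove j)) := rfl

/-- The Leibniz rule. -/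
lemma diff_cup {L M N : Mod k G} {a b n : ℕ} (h : a + b = n) (f : Cochain M N a)
    (g : Cochain L M b) :
    diff L N n (cup h f g) = cup (by omega : a + 1 + b = n + 1) (diff M N a f) g +
      (-1 : k) ^ a • cup (by omega : a + (b + 1) = n + 1) f (diff L M b g) := by
  subst h
  ext x m
  obtain ⟨y, hy⟩ : ∃ y : ℕ → G, ∀ i : Fin (a + b + 2), x i = y i :=
    ⟨fun i => if hi : i < a + b + 2 then x ⟨i, hi⟩ else 1, fun i => by simp⟩
  have face : ∀ (n i : ℕ) (hi : i < n + 1) (j : Fin n),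
      ((Fin.succAbove ⟨i, hi⟩ j : Fin (n + 1)) : ℕ) = if (j : ℕ) < i then (j : ℕ) else j + 1 := by
    intro n i hi j
    simp only [Fin.succAbove, Fin.lt_def, Fin.val_castSucc]
    split_ifs <;> simp
  let T : ℕ → N := fun i => (-1 : k) ^ i •
    f.val (fun j => y (if (j : ℕ) < i then (j : ℕ) else j + 1))
      (g.val (fun j => y (if a + (j : ℕ) < i then a + (j : ℕ) else a + j + 1)) m)
  let U : ℕ → N := fun i => (-1 : k) ^ i •
    f.val (fun j => y (if (j : ℕ) < i then (j : ℕ) else j + 1)) (g.val (fun j => y (a + 1 + j)) m)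
  let V : ℕ → N := fun i => (-1 : k) ^ i •
    f.val (fun j => y j) (g.val (fun j => y (a + (if (j : ℕ) < i then (j : ℕ) else j + 1))) m)
  have hT : (diff L N (a + b) (cup rfl f g)).val x m = ∑ i ∈ Finset.range (a + b + 2), T i := by
    rw [diff_apply, ← Fin.sum_univ_eq_sum_range, LinearMap.sum_apply]
    refine Finset.sum_congr rfl fun i _ => ?_
    simp only [LinearMap.smul_apply, cup_apply, LinearMap.comp_apply, hy, face, T]
  have hU : (cup (by omega : a + 1 + b = a + b + 1) (diff M N a f) g).val x m =
      ∑ i ∈ Finset.range (a + 2), U i := by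
    rw [cup_apply, diff_apply, ← Fin.sum_univ_eq_sum_range, LinearMap.comp_apply,
      LinearMap.sum_apply]
    refine Finset.sum_congr rfl fun i _ => ?_
    simp only [LinearMap.smul_apply, hy, face, U]
  have hV : (cup (by omega : a + (b + 1) = a + b + 1) f (diff L M b g)).val x m =
      ∑ i ∈ Finset.range (b + 2), V i := by
    rw [cup_apply, diff_apply, ← Fin.sum_univ_eq_sum_range, LinearMap.comp_apply,
      LinearMap.sum_apply, map_sum]
    refine Finset.sum_congr rfl fun i _ => ?_
    simp only [LinearMap.smul_apply, map_smul, hy, face, V]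
  have h1 : ∀ i ∈ Finset.range (a + 1), T i = U i := fun i hi => by
    have hi' := Finset.mem_range.1 hi
    simp only [T, U]
    congr 3
    refine congrArg g.val (funext fun j => ?_)
    rw [if_neg (by omega)]
    congr 1
    omega
  have h2 : ∀ i ∈ Finset.range (b + 1), T (a + 1 + i) = (-1 : k) ^ a • V (i + 1) := fun i _ => by
    simp only [T, V, smul_smul, ← pow_add]
    congr 1
    · congr 1
      omega
    congr 2
    · funext j
      rw [if_pos (by omega)]
    · refine congrArg g.val (funext fun j => ?_)
      congr 1
      split_ifs <;> omega
  have h3 : U (a + 1) = -((-1 : k) ^ a • V 0) := by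
    simp only [U, V, pow_succ, pow_zero, one_smul, mul_neg, mul_one, neg_smul]
    congr 3
    · refine congrArg f.val (funext fun j => ?_)
      rw [if_pos (by omega)]
    · refine congrArg (fun z => g.val z m) (funext fun j => ?_)
      congr 1
      simp
      omega
  simp only [Cochain.add_val, Cochain.smul_val, Pi.add_apply, Pi.smul_apply, LinearMap.add_apply,
    LinearMap.smul_apply]
  rw [hT, hU, hV, show a + b + 2 = (a + 1) + (b + 1) by omega, Finset.sum_range_add,
    Finset.sum_congr rfl h1, Finset.sum_congr rfl h2, Finset.sum_range_succ U (a + 1),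
    Finset.sum_range_succ' V (b + 1), h3, smul_add, Finset.smul_sum]
  abel

lemma cup_mem_cocycles {L M N : Mod k G} {a b n : ℕ} (h : a + b = n) {f : Cochain M N a}
    {g : Cochain L M b} (hf : f ∈ cocycles M N a) (hg : g ∈ cocycles L M b) :
    cup h f g ∈ cocycles L N n := by
  rw [cocycles, LinearMap.mem_ker] at hf hg ⊢
  rw [diff_cup, hf, hg]
  simp

lemma cup_mem_coboundaries_left {L M N : Mod k G} {a b n : ℕ} (h : a + b = n) {f : Cochain M N a}
    {g : Cochain L M b} (hf : f ∈ coboundaries M N a) (hg : g ∈ cocycles L M b) :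
    cup h f g ∈ coboundaries L N n := by
  rw [cocycles, LinearMap.mem_ker] at hg
  cases a with
  | zero =>
    rw [(Submodule.mem_bot k).1 hf]
    simp
  | succ a =>
    obtain ⟨e, rfl⟩ := hf
    obtain rfl : n = (a + b) + 1 := by omega
    exact ⟨cup rfl e g, by rw [diff_cup, hg]; simp⟩

lemma cup_mem_coboundaries_right {L M N : Mod k G} {a b n : ℕ} (h : a + b = n)
    {f : Cochain M N a} {g : Cochain L M b} (hf : f ∈ cocycles M N a)
    (hg : g ∈ coboundaries L M b) : cup h f g ∈ coboundaries L N n := by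
  rw [cocycles, LinearMap.mem_ker] at hf
  cases b with
  | zero =>
    rw [(Submodule.mem_bot k).1 hg]
    simp
  | succ b =>
    obtain ⟨e, rfl⟩ := hg
    obtain rfl : n = (a + b) + 1 := by omega
    refine ⟨(-1 : k) ^ a • cup rfl f e, ?_⟩
    rw [map_smul, diff_cup, hf]
    simp [smul_smul, ← mul_pow]

/-- The class in `Ext` of a cocycle. -/
def RelExt.mk {M N : Mod k G} {n : ℕ} : cocycles M N n →ₗ[k] RelExt M N n :=
  Submodule.mkQ _

/-- The composition product on cocycles. -/
def cupCocycles (L M N : Mod k G) (a b : ℕ) :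
    cocycles M N a →ₗ[k] cocycles L M b →ₗ[k] cocycles L N (a + b) :=
  LinearMap.mk₂ k (fun f g => ⟨cup rfl f.1 g.1, cup_mem_cocycles rfl f.2 g.2⟩)
    (fun f f' g => Subtype.ext (by simp)) (fun c f g => Subtype.ext (by simp))
    (fun f g g' => Subtype.ext (by simp)) (fun c f g => Subtype.ext (by simp))

/-- The composition (Yoneda) product
`Ext^a_{G,1}(M, N) × Ext^b_{G,1}(L, M) → Ext^{a+b}_{G,1}(L, N)`. -/
def RelExt.comp {L M N : Mod k G} {a b : ℕ} :
    RelExt M N a →ₗ[k] RelExt L M b →ₗ[k] RelExt L N (a + b) :=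
  Submodule.liftQ _
    { toFun := fun f => Submodule.mapQ _ _ (cupCocycles L M N a b f)
        fun _ hg => cup_mem_coboundaries_right rfl f.2 hg
      map_add' := fun f f' => Submodule.linearMap_qext _ <| LinearMap.ext fun g =>
        congrArg (Submodule.Quotient.mk) (LinearMap.map_add₂ (cupCocycles L M N a b) f f' g)
      map_smul' := fun c f => Submodule.linearMap_qext _ <| LinearMap.ext fun g =>
        congrArg (Submodule.Quotient.mk) (LinearMap.map_smul₂ (cupCocycles L M N a b) c f g) }
    fun _ hf => LinearMap.mem_ker.2 <| Submodule.linearMap_qext _ <| LinearMap.ext fun g =>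
      (Submodule.Quotient.mk_eq_zero _).2 (cup_mem_coboundaries_left rfl hf g.2)

variable (k G) in
/-- The trivial `kG`-module `k`. -/
abbrev unitMod : Mod k G := Rep.trivial k G k

variable (k G) in
/-- `H^n(G, k) = Ext^n_{G,1}(k, k)`, with product `RelExt.comp`. -/
abbrev Coh (n : ℕ) : Type u := RelExt (unitMod k G) (unitMod k G) n

/-- The map on cochains induced by `- ⊗_k M`; a cochain with values in `End_k(k) = k` is sent to
the corresponding cochain of scalar endomorphisms of `M`. -/
def zetaCochain (M : Mod k G) (n : ℕ) :
    Cochain (unitMod k G) (unitMod k G) n →ₗ[k] Cochain M M n where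
  toFun s := .mk (fun x => (s.val x (1 : k) : k) • LinearMap.id) fun h x => by
    have hs : s.val (fun i => h * x i) (1 : k) = s.val x (1 : k) := LinearMap.congr_fun (s.prop h x) 1
    rw [hs]
    ext m
    simp
  map_add' s t := by
    refine Cochain.ext fun x m => ?_
    simp only [Cochain.add_val, Cochain.mk_val]
    exact add_smul (s.val x (1 : k) : k) (t.val x (1 : k) : k) m
  map_smul' c s := by
    refine Cochain.ext fun x m => ?_
    simp only [Cochain.smul_val, Cochain.mk_val]
    exact mul_smul c (s.val x (1 : k) : k) m

lemma diff_zetaCochain (M : Mod k G) (n : ℕ) (s : Cochain (unitMod k G) (unitMod k G) n) :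
    diff M M n (zetaCochain M n s) = zetaCochain M (n + 1) (diff _ _ n s) := by
  ext x m
  simp only [diff_apply, zetaCochain, LinearMap.coe_mk, AddHom.coe_mk, Cochain.mk_val,
    LinearMap.sum_apply, LinearMap.smul_apply, LinearMap.id_apply, Finset.sum_smul, smul_assoc]

/-- `zetaCochain` on cocycles. -/
def zetaCocycles (M : Mod k G) (n : ℕ) :
    cocycles (unitMod k G) (unitMod k G) n →ₗ[k] cocycles M M n :=
  (zetaCochain M n).restrict fun s hs => by
    rw [cocycles, LinearMap.mem_ker] at hs ⊢
    rw [diff_zetaCochain, hs, map_zero]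

/-- The homomorphism `ζ_M : H^*(G, k) → Ext^*_{G,1}(M, M)` induced by `- ⊗_k M`. -/
def zeta (M : Mod k G) {n : ℕ} : Coh k G n →ₗ[k] RelExt M M n :=
  Submodule.mapQ _ _ (zetaCocycles M n) fun s hs => by
    change zetaCochain M n s.1 ∈ coboundaries M M n
    replace hs : s.1 ∈ coboundaries _ _ n := hs
    cases n with
    | zero =>
      rw [(Submodule.mem_bot k).1 hs, map_zero]
      exact zero_mem _
    | succ n =>
      obtain ⟨e, he⟩ := hs
      exact ⟨zetaCochain M n e, by rw [diff_zetaCochain, he]⟩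

variable (k G) in
/-- The space `𝒱_G` of homogeneous prime ideals of the graded-commutative ring `H^*(G, k)` not
containing the ideal `H^{≥ 1}(G, k)`; a homogeneous ideal is given by its graded pieces. The last
condition implies that the ideal is proper. -/
@[ext] structure CohSpec where
  piece : ∀ n : ℕ, Submodule k (Coh k G n)
  mul_mem_left : ∀ {a b : ℕ} (s : Coh k G a) (t : Coh k G b),
    t ∈ piece b → RelExt.comp s t ∈ piece (a + b)
  mul_mem_right : ∀ {a b : ℕ} (s : Coh k G a) (t : Coh k G b),
    s ∈ piece a → RelExt.comp s t ∈ piece (a + b)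
  mem_or_mem : ∀ {a b : ℕ} (s : Coh k G a) (t : Coh k G b),
    RelExt.comp s t ∈ piece (a + b) → s ∈ piece a ∨ t ∈ piece b
  not_irrelevant : ∃ n : ℕ, 1 ≤ n ∧ ∃ s : Coh k G n, s ∉ piece n

/-- The support `𝒱_G(M)`: those `𝔭` with `Ext^*_{G,1}(M, M)_𝔭 ≠ 0`, that is, such that some
homogeneous element is annihilated by no homogeneous `s ∉ 𝔭` (acting through `ζ_M`). -/
def supp (M : Mod k G) : Set (CohSpec k G) :=
  {𝔭 | ∃ (b : ℕ) (x : RelExt M M b), ∀ (a : ℕ) (s : Coh k G a), s ∉ 𝔭.piece a →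
    RelExt.comp (zeta M s) x ≠ 0}

/-- Specialisation closed subsets of `𝒱_G`. -/
def IsSpecializationClosed (W : Set (CohSpec k G)) : Prop :=
  ∀ 𝔭 ∈ W, ∀ 𝔮 : CohSpec k G, (∀ n, 𝔭.piece n ≤ 𝔮.piece n) → 𝔮 ∈ W

variable (k G) in
/-- The assignment `C ↦ ⋃_{M ∈ C} 𝒱_G(M)` from thick tensor ideals of `stmod(kG)` to
specialisation closed subsets of `𝒱_G`, where `M` runs through the finitely presented modules
in `C`. -/
def suppMap (C : ThickTensorIdeal k G) : {W : Set (CohSpec k G) // IsSpecializationClosed W} :=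
  ⟨{𝔭 | ∃ M : Mod k G, IsFinPres M ∧ C.1 ((toStMod k G).obj M) ∧ 𝔭 ∈ supp M}, by
    rintro 𝔭 ⟨M, hM, hC, b, x, hx⟩ 𝔮 h
    exact ⟨M, hM, hC, b, x, fun a s hs => hx a s fun hs' => hs (h a hs')⟩⟩

end Cohomology

end StableRep

end

/-! By Higman's criterion (`isPHom_iff`), a morphism is stably zero exactly when it is a trace `∑ g
θ g⁻¹` of a `k`-linear map, so membership in `D_n` becomes an equation. With `c = p^n`, a module is
stably isomorphic to one annihilated by `c` iff `c • id = c • trace θ` for some linear `θ`: then `id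
- trace θ` factors through `V/c` and inverts `V → V/c` stably (`isTraceModulo_iff_exists_iso`).

This equation visibly passes to retracts and tensor products. For triangles it is restated as weak
projectivity of the homotopy fiber of `V → V/c` (`isTraceModulo_iff`). That fiber is additive and
functorial in all `k`-linear maps, so it preserves `k`-split sequences, along which weak
projectivity has the two-out-of-three property.

On a trivial module the trace is multiplication by `|G|`, a multiple of `p`. Hence `p^n = p^n |G| a`
is insoluble in `ℤ` and in `ℤ/p^m` for `m > n`, which gives strictness and excludes `ℤ`.

Supports do not see `n`. Composition with a trace is zero on relative cohomology in positive
degrees, so `p^n` kills `Ext^{≥1}(M, M)` for `M` in `D_n`, and every prime in the support contains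
`p`. Conversely, the kernel of `H^*(G, ℤ) → H^*(G, ℤ/p^n)` is `p^n H^*(G, ℤ)`, so every prime
containing `p` supports `ℤ/p^n` (`supp_zmod`). Thus `D_1 ≠ D_2` have the same support. -/

noncomputable section

namespace StableRep

set_option linter.unusedSectionVars false

/-! ### Traces of linear maps, and splitting of `k`-split sequences. -/

section Trace

variable {k : Type*} [CommRing k] {G : Type*} [Group G] [Fintype G]
variable {U V W X : Type*} [AddCommGroup U] [Module k U] [AddCommGroup V] [Module k V]
  [AddCommGroup W] [Module k W] [AddCommGroup X] [Module k X]

/-- The trace `∑ g, g θ g⁻¹` of a linear map between representations. -/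
def trace (ρ : Representation k G V) (σ : Representation k G W) (θ : V →ₗ[k] W) : V →ₗ[k] W :=
  ∑ g, σ g ∘ₗ θ ∘ₗ ρ g⁻¹

lemma trace_apply (ρ : Representation k G V) (σ : Representation k G W) (θ : V →ₗ[k] W) (v : V) :
    trace ρ σ θ v = ∑ g, σ g (θ (ρ g⁻¹ v)) := by
  simp [trace]

/-- A linear map commuting with the actions of `G`. -/
def IsEquivariant (ρ : Representation k G V) (σ : Representation k G W) (f : V →ₗ[k] W) : Prop :=
  ∀ g v, f (ρ g v) = σ g (f v)

lemma isEquivariant_trace (ρ : Representation k G V) (σ : Representation k G W) (θ : V →ₗ[k] W) :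
    IsEquivariant ρ σ (trace ρ σ θ) := fun h v => by
  rw [trace_apply, trace_apply, map_sum]
  refine Fintype.sum_equiv (Equiv.mulLeft h⁻¹) _ _ fun g => ?_
  simp [← Module.End.mul_apply, ← map_mul]

lemma trace_add (ρ : Representation k G V) (σ : Representation k G W) (θ η : V →ₗ[k] W) :
    trace ρ σ (θ + η) = trace ρ σ θ + trace ρ σ η := by
  ext v
  simp [trace_apply, Finset.sum_add_distrib]

lemma trace_neg (ρ : Representation k G V) (σ : Representation k G W) (θ : V →ₗ[k] W) :
    trace ρ σ (-θ) = -trace ρ σ θ := by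
  ext v
  simp [trace_apply]

lemma IsEquivariant.comp_trace {ρ : Representation k G V} {σ : Representation k G W}
    {τ : Representation k G X} {f : W →ₗ[k] X} (hf : IsEquivariant σ τ f) (θ : V →ₗ[k] W) :
    f ∘ₗ trace ρ σ θ = trace ρ τ (f ∘ₗ θ) := by
  ext v
  simp [trace_apply, hf _ _]

lemma IsEquivariant.trace_comp {ρ : Representation k G V} {σ : Representation k G W}
    {τ : Representation k G X} {f : V →ₗ[k] W} (hf : IsEquivariant ρ σ f) (θ : W →ₗ[k] X) :
    trace σ τ θ ∘ₗ f = trace ρ τ (θ ∘ₗ f) := by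
  ext v
  simp [trace_apply, hf _ _]

/-- The identity is a trace: Higman's criterion for weak projectivity. -/
def IdIsTrace (ρ : Representation k G V) : Prop := ∃ ψ : V →ₗ[k] V, trace ρ ρ ψ = LinearMap.id

/-- The data of a short exact sequence of representations that is split over `k`. -/
structure SplitSequence (ρ₁ : Representation k G U) (ρ₂ : Representation k G V)
    (ρ₃ : Representation k G W) where
  f : U →ₗ[k] V
  g : V →ₗ[k] W
  r : V →ₗ[k] U
  s : W →ₗ[k] V
  f_equivariant : IsEquivariant ρ₁ ρ₂ f
  g_equivariant : IsEquivariant ρ₂ ρ₃ g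
  r_f : r ∘ₗ f = LinearMap.id
  g_s : g ∘ₗ s = LinearMap.id
  g_f : g ∘ₗ f = 0
  add_id : f ∘ₗ r + s ∘ₗ g = LinearMap.id

namespace SplitSequence

variable {ρ₁ : Representation k G U} {ρ₂ : Representation k G V} {ρ₃ : Representation k G W}
  (S : SplitSequence ρ₁ ρ₂ ρ₃)

lemma f_injective : Function.Injective S.f :=
  Function.LeftInverse.injective (g := S.r) fun x => LinearMap.congr_fun S.r_f x

lemma g_surjective : Function.Surjective S.g :=
  Function.RightInverse.surjective (g := S.s) fun x => LinearMap.congr_fun S.g_s x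

/-- An equivariant splitting. -/
def IsSplit : Prop := ∃ (r : V →ₗ[k] U) (s : W →ₗ[k] V), IsEquivariant ρ₂ ρ₁ r ∧
  IsEquivariant ρ₃ ρ₂ s ∧ r ∘ₗ S.f = LinearMap.id ∧ S.g ∘ₗ s = LinearMap.id ∧
  S.f ∘ₗ r + s ∘ₗ S.g = LinearMap.id

/-- Averaging the linear section: `trace (s ψ)` is equivariant, and `g` moves inside the trace to
give `trace ψ = id`. The matching retraction is equivariant because it becomes so after the
injection `f`. -/
lemma isSplit_of_right (h : IdIsTrace ρ₃) : S.IsSplit := by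
  obtain ⟨ψ, hψ⟩ := h
  set s := trace ρ₃ ρ₂ (S.s ∘ₗ ψ) with hs
  have hse : IsEquivariant ρ₃ ρ₂ s := isEquivariant_trace _ _ _
  have hgs : S.g ∘ₗ s = LinearMap.id := by
    rw [hs, S.g_equivariant.comp_trace, ← LinearMap.comp_assoc, S.g_s, LinearMap.id_comp, hψ]
  have hgs' (x) : S.g (s x) = x := LinearMap.congr_fun hgs x
  have hgf (x) : S.g (S.f x) = 0 := LinearMap.congr_fun S.g_f x
  have hadd (x) : S.f (S.r x) + S.s (S.g x) = x := LinearMap.congr_fun S.add_id x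
  have hsum : S.f ∘ₗ (S.r ∘ₗ (LinearMap.id - s ∘ₗ S.g)) + s ∘ₗ S.g = LinearMap.id := by
    ext x
    have := hadd (x - s (S.g x))
    rw [map_sub S.g, hgs', sub_self, map_zero, add_zero] at this
    simp only [LinearMap.add_apply, LinearMap.comp_apply, LinearMap.sub_apply, LinearMap.id_apply,
      this, sub_add_cancel]
  refine ⟨S.r ∘ₗ (LinearMap.id - s ∘ₗ S.g), s, fun g v => S.f_injective ?_, hse, ?_, hgs, hsum⟩
  · have h1 := LinearMap.congr_fun hsum (ρ₂ g v)
    have h2 := congrArg (ρ₂ g) (LinearMap.congr_fun hsum v)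
    rw [LinearMap.add_apply, LinearMap.id_apply, ← eq_sub_iff_add_eq] at h1
    rw [LinearMap.add_apply, LinearMap.id_apply, map_add, ← eq_sub_iff_add_eq] at h2
    rw [S.f_equivariant]
    refine h1.trans (Eq.trans ?_ h2.symm)
    simp [S.g_equivariant g v, hse g _]
  · ext x
    have := LinearMap.congr_fun S.r_f x
    simpa [hgf] using this

/-- Dual argument: `trace (ψ r)` is an equivariant retraction, and equivariance of the section is
tested on the image of the surjection `g`. -/
lemma isSplit_of_left (h : IdIsTrace ρ₁) : S.IsSplit := by
  obtain ⟨ψ, hψ⟩ := h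
  set r := trace ρ₂ ρ₁ (ψ ∘ₗ S.r) with hr
  have hre : IsEquivariant ρ₂ ρ₁ r := isEquivariant_trace _ _ _
  have hrf : r ∘ₗ S.f = LinearMap.id := by
    rw [hr, S.f_equivariant.trace_comp, LinearMap.comp_assoc, S.r_f, LinearMap.comp_id, hψ]
  have hrf' (x) : r (S.f x) = x := LinearMap.congr_fun hrf x
  have hgf (x) : S.g (S.f x) = 0 := LinearMap.congr_fun S.g_f x
  have hadd (x) : S.f (S.r x) + S.s (S.g x) = x := LinearMap.congr_fun S.add_id x
  have hsum : S.f ∘ₗ r + ((LinearMap.id - S.f ∘ₗ r) ∘ₗ S.s) ∘ₗ S.g = LinearMap.id := by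
    ext x
    have h1 : S.s (S.g x) = x - S.f (S.r x) := eq_sub_of_add_eq' (hadd x)
    simp [h1, hrf']
  refine ⟨r, (LinearMap.id - S.f ∘ₗ r) ∘ₗ S.s, hre, fun g w => ?_, hrf, ?_, hsum⟩
  · obtain ⟨v, rfl⟩ := S.g_surjective w
    have h1 := LinearMap.congr_fun hsum (ρ₂ g v)
    have h2 := congrArg (ρ₂ g) (LinearMap.congr_fun hsum v)
    rw [LinearMap.add_apply, LinearMap.id_apply, ← eq_sub_iff_add_eq'] at h1
    rw [LinearMap.add_apply, LinearMap.id_apply, map_add, ← eq_sub_iff_add_eq'] at h2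
    rw [← S.g_equivariant]
    refine h1.trans (Eq.trans ?_ h2.symm)
    simp [S.f_equivariant g _, hre g _]
  · ext x
    have := LinearMap.congr_fun S.g_s x
    simpa [hgf] using this

/-- Two out of three holds because the sequence splits equivariantly as soon as an outer term is
weakly projective; the identity of the remaining term is then assembled by conjugating `ψ` with the
splitting maps. -/
lemma idIsTrace₁ (S : SplitSequence ρ₁ ρ₂ ρ₃)
    (h₂ : IdIsTrace ρ₂) (h₃ : IdIsTrace ρ₃) : IdIsTrace ρ₁ := by
  obtain ⟨r, s, hr, hs, hrf, hgs, hsum⟩ := S.isSplit_of_right h₃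
  obtain ⟨ψ, hψ⟩ := h₂
  refine ⟨r ∘ₗ ψ ∘ₗ S.f, ?_⟩
  rw [← hr.comp_trace, ← S.f_equivariant.trace_comp, hψ, LinearMap.id_comp, hrf]

lemma idIsTrace₃ (S : SplitSequence ρ₁ ρ₂ ρ₃)
    (h₁ : IdIsTrace ρ₁) (h₂ : IdIsTrace ρ₂) : IdIsTrace ρ₃ := by
  obtain ⟨r, s, hr, hs, hrf, hgs, hsum⟩ := S.isSplit_of_left h₁
  obtain ⟨ψ, hψ⟩ := h₂
  refine ⟨S.g ∘ₗ ψ ∘ₗ s, ?_⟩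
  rw [← S.g_equivariant.comp_trace, ← hs.trace_comp, hψ, LinearMap.id_comp, hgs]

lemma idIsTrace₂ (S : SplitSequence ρ₁ ρ₂ ρ₃)
    (h₁ : IdIsTrace ρ₁) (h₃ : IdIsTrace ρ₃) : IdIsTrace ρ₂ := by
  obtain ⟨r, s, hr, hs, hrf, hgs, hsum⟩ := S.isSplit_of_left h₁
  obtain ⟨ψ₁, hψ₁⟩ := h₁
  obtain ⟨ψ₃, hψ₃⟩ := h₃
  refine ⟨S.f ∘ₗ ψ₁ ∘ₗ r + s ∘ₗ ψ₃ ∘ₗ S.g, ?_⟩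
  rw [trace_add, ← S.f_equivariant.comp_trace, ← hr.trace_comp, ← hs.comp_trace,
    ← S.g_equivariant.trace_comp, hψ₁, hψ₃, LinearMap.id_comp, LinearMap.id_comp, hsum]

end SplitSequence

/-! ### The homotopy fiber of `V → V/c`. -/

section Fiber

variable (c : k)

variable (V) in
/-- The multiples of `c`. -/
abbrev multiples : Submodule k V := LinearMap.range (LinearMap.lsmul k V c)

/-- The map induced on the quotients by the multiples of `c`. -/
def reduce (α : V →ₗ[k] W) : V ⧸ multiples V c →ₗ[k] W ⧸ multiples W c :=
  Submodule.mapQ _ _ α (by rintro _ ⟨v, rfl⟩; exact ⟨α v, by simp⟩)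

@[simp] lemma reduce_mk (α : V →ₗ[k] W) (v : V) :
    reduce c α (Submodule.Quotient.mk v) = Submodule.Quotient.mk (α v) := rfl

lemma reduce_comp (β : W →ₗ[k] X) (α : V →ₗ[k] W) :
    reduce c (β ∘ₗ α) = reduce c β ∘ₗ reduce c α := by
  ext v; simp

lemma reduce_id : reduce c (LinearMap.id : V →ₗ[k] V) = LinearMap.id := by
  ext v; simp

/-- The action on the quotient by the multiples of `c`. -/
def reduceRep (ρ : Representation k G V) : Representation k G (V ⧸ multiples V c) where
  toFun g := reduce c (ρ g)
  map_one' := by rw [map_one]; exact reduce_id c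
  map_mul' g h := by rw [map_mul]; exact reduce_comp c _ _

@[simp] lemma reduceRep_mk (ρ : Representation k G V) (g : G) (v : V) :
    reduceRep c ρ g (Submodule.Quotient.mk v) = Submodule.Quotient.mk (ρ g v) := rfl

variable (G V) in
/-- The underlying module of the homotopy fiber of `V → V/c`: the kernel of
`V ⊕ Ind(V/c) → V/c`. -/
def Fiber : Submodule k (V × (G → V ⧸ multiples V c)) where
  carrier := {x | Submodule.Quotient.mk x.1 + ∑ h, x.2 h = 0}
  add_mem' {x y} hx hy := by
    simp only [Set.mem_ofPred_eq, Prod.fst_add, Prod.snd_add, Pi.add_apply,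
      Finset.sum_add_distrib, Submodule.Quotient.mk_add] at hx hy ⊢
    rw [add_add_add_comm, hx, hy, add_zero]
  zero_mem' := by simp
  smul_mem' a x hx := by
    simp only [Set.mem_ofPred_eq, Prod.smul_fst, Prod.smul_snd, Pi.smul_apply,
      Submodule.Quotient.mk_smul, ← Finset.smul_sum, ← smul_add] at hx ⊢
    rw [hx, smul_zero]

lemma mem_fiber {x : V × (G → V ⧸ multiples V c)} :
    x ∈ Fiber G V c ↔ Submodule.Quotient.mk x.1 + ∑ h, x.2 h = 0 := Iff.rfl

/-- The diagonal action on the homotopy fiber. -/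
def fiberRep (ρ : Representation k G V) : Representation k G (Fiber G V c) where
  toFun g := (LinearMap.prodMap (ρ g)
      (LinearMap.pi fun h => reduceRep c ρ g ∘ₗ LinearMap.proj (g⁻¹ * h))).restrict fun x hx => by
    rw [mem_fiber] at hx ⊢
    have := congrArg (reduceRep c ρ g) hx
    rw [map_add, map_sum, map_zero, reduceRep_mk] at this
    rw [← this]
    simp only [LinearMap.prodMap_apply, LinearMap.pi_apply, LinearMap.comp_apply,
      LinearMap.proj_apply]
    congr 1
    exact Fintype.sum_equiv (Equiv.mulLeft g⁻¹) _ _ fun h => rfl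
  map_one' := by
    ext x <;> simp
  map_mul' g h := by
    ext x <;> simp [mul_assoc]

lemma fiberRep_fst (ρ : Representation k G V) (g : G) (x : Fiber G V c) :
    (fiberRep c ρ g x).1.1 = ρ g x.1.1 := rfl

lemma fiberRep_snd (ρ : Representation k G V) (g : G) (x : Fiber G V c) (h : G) :
    (fiberRep c ρ g x).1.2 h = reduceRep c ρ g (x.1.2 (g⁻¹ * h)) := rfl

variable (G) in
/-- Functoriality of the homotopy fiber for all linear maps. -/
def fiberMap (α : V →ₗ[k] W) : Fiber G V c →ₗ[k] Fiber G W c :=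
  (LinearMap.prodMap α (LinearMap.pi fun h => reduce c α ∘ₗ LinearMap.proj h)).restrict
    fun x hx => by
      rw [mem_fiber] at hx ⊢
      have := congrArg (reduce c α) hx
      rw [map_add, map_sum, map_zero, reduce_mk] at this
      exact this

lemma fiberMap_snd (α : V →ₗ[k] W) (x : Fiber G V c) (h : G) :
    (fiberMap G c α x).1.2 h = reduce c α (x.1.2 h) := rfl

lemma fiber_ext {x y : Fiber G V c} (h₁ : x.1.1 = y.1.1) (h₂ : ∀ h, x.1.2 h = y.1.2 h) : x = y :=
  Subtype.ext (Prod.ext h₁ (funext h₂))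

lemma fiberMap_comp (β : W →ₗ[k] X) (α : V →ₗ[k] W) :
    fiberMap G c (β ∘ₗ α) = fiberMap G c β ∘ₗ fiberMap G c α := by
  refine LinearMap.ext fun x => fiber_ext c rfl fun h => ?_
  rw [fiberMap_snd, reduce_comp]
  rfl

lemma fiberMap_id : fiberMap G c (LinearMap.id : V →ₗ[k] V) = LinearMap.id := by
  refine LinearMap.ext fun x => fiber_ext c rfl fun h => ?_
  rw [fiberMap_snd, reduce_id]
  rfl

lemma fiberMap_add (α β : V →ₗ[k] W) :
    fiberMap G c (α + β) = fiberMap G c α + fiberMap G c β := by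
  refine LinearMap.ext fun x => fiber_ext c rfl fun h => ?_
  rw [fiberMap_snd]
  obtain ⟨v, hv⟩ := Submodule.Quotient.mk_surjective _ (x.1.2 h)
  change _ = reduce c α (x.1.2 h) + reduce c β (x.1.2 h)
  rw [← hv]
  simp

lemma fiberMap_zero : fiberMap G c (0 : V →ₗ[k] W) = 0 := by
  refine LinearMap.ext fun x => fiber_ext c rfl fun h => ?_
  obtain ⟨v, hv⟩ := Submodule.Quotient.mk_surjective _ (x.1.2 h)
  rw [fiberMap_snd, ← hv]
  rfl

lemma IsEquivariant.fiberMap {ρ : Representation k G V} {σ : Representation k G W} {α : V →ₗ[k] W}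
    (hα : IsEquivariant ρ σ α) : IsEquivariant (fiberRep c ρ) (fiberRep c σ) (fiberMap G c α) := by
  refine fun g x => fiber_ext c (hα g _) fun h => ?_
  rw [fiberMap_snd, fiberRep_snd, fiberRep_snd, fiberMap_snd]
  obtain ⟨v, hv⟩ := Submodule.Quotient.mk_surjective _ (x.1.2 (g⁻¹ * h))
  rw [← hv]
  simp [hα g v]

/-- The homotopy fiber of a `k`-split sequence. -/
def SplitSequence.fiber {ρ₁ : Representation k G U} {ρ₂ : Representation k G V}
    {ρ₃ : Representation k G W} (S : SplitSequence ρ₁ ρ₂ ρ₃) :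
    SplitSequence (fiberRep c ρ₁) (fiberRep c ρ₂) (fiberRep c ρ₃) where
  f := fiberMap G c S.f
  g := fiberMap G c S.g
  r := fiberMap G c S.r
  s := fiberMap G c S.s
  f_equivariant := S.f_equivariant.fiberMap c
  g_equivariant := S.g_equivariant.fiberMap c
  r_f := by rw [← fiberMap_comp, S.r_f, fiberMap_id]
  g_s := by rw [← fiberMap_comp, S.g_s, fiberMap_id]
  g_f := by rw [← fiberMap_comp, S.g_f, fiberMap_zero]
  add_id := by rw [← fiberMap_comp, ← fiberMap_comp, ← fiberMap_add, S.add_id, fiberMap_id]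

/-- `c • id` and `c • trace θ` agree for some `θ`; this says that `V → V/c` is an isomorphism in
the stable category. -/
def IsTraceModulo (ρ : Representation k G V) : Prop :=
  ∃ θ : V →ₗ[k] V, ∀ v, c • v = c • trace ρ ρ θ v

lemma fiber_sum_fst (f : G → Fiber G V c) :
    (∑ g, f g).1.1 = ∑ g, (f g).1.1 := by
  simp [Prod.fst_sum]

lemma fiber_sum_snd (f : G → Fiber G V c) (h : G) :
    (∑ g, f g).1.2 h = ∑ g, (f g).1.2 h := by
  simp [Prod.snd_sum]

-- The map `id - trace θ` descends to `r : V/c → V`, a stable inverse of `V → V/c`, so the fiber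
-- should be stably zero; `ψ₀` is an explicit contraction.
open Classical in
lemma IsTraceModulo.idIsTrace_fiberRep {ρ : Representation k G V} (h : IsTraceModulo c ρ) :
    IdIsTrace (fiberRep c ρ) := by
  obtain ⟨θ, hθ⟩ := h
  have hr (g : G) (w : V ⧸ multiples V c) : reduceRep c ρ g (reduceRep c ρ g⁻¹ w) = w := by
    rw [← Module.End.mul_apply, ← map_mul]
    simp
  let r : V ⧸ multiples V c →ₗ[k] V := Submodule.liftQ _ (LinearMap.id - trace ρ ρ θ) (by
    rintro _ ⟨v, rfl⟩
    simpa [smul_sub, sub_eq_zero] using hθ v)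
  have hrmk (v : V) : r (Submodule.Quotient.mk v) = v - trace ρ ρ θ v := rfl
  have hre : IsEquivariant (reduceRep c ρ) ρ r := fun g w => by
    obtain ⟨v, rfl⟩ := Submodule.Quotient.mk_surjective _ w
    rw [reduceRep_mk, hrmk, hrmk, map_sub, isEquivariant_trace ρ ρ θ g v]
  let η : V ⧸ multiples V c →ₗ[k] V ⧸ multiples V c := reduce c θ
  have hη (v : V) : ∑ g, reduceRep c ρ g (η (reduceRep c ρ g⁻¹ (Submodule.Quotient.mk v))) =
      Submodule.Quotient.mk (trace ρ ρ θ v) := by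
    rw [trace_apply, ← Submodule.mkQ_apply, ← Submodule.mkQ_apply, map_sum]
    rfl
  let e : V × (G → V ⧸ multiples V c) →ₗ[k] V ⧸ multiples V c :=
    LinearMap.proj 1 ∘ₗ LinearMap.snd k _ _
  -- In the trace, the value at `1` of the translates of `x.2` runs through all of `x.2`, whose sum
  -- is `-x.1` mod `c` on the fiber. Hence `-r` contributes `x.1 - trace θ x.1`, completing `trace θ
  -- x.1`. The single term at `1` traces to `x.2` minus an error in `θ`, which the last term cancels
  -- while keeping the image in the fiber.
  let ψ₀ : V × (G → V ⧸ multiples V c) →ₗ[k] V × (G → V ⧸ multiples V c) :=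
    LinearMap.prod (θ ∘ₗ LinearMap.fst k _ _ - r ∘ₗ e)
      (LinearMap.single k (fun _ : G => V ⧸ multiples V c) 1 ∘ₗ
        (e - Submodule.mkQ _ ∘ₗ θ ∘ₗ LinearMap.fst k _ _) -
        LinearMap.pi fun h => reduceRep c ρ h ∘ₗ η ∘ₗ reduceRep c ρ h⁻¹ ∘ₗ e)
  have hψ₁ (x) : (ψ₀ x).1 = θ x.1 - r (x.2 1) := rfl
  have hψ₂ (x) (h : G) : (ψ₀ x).2 h =
      Pi.single (M := fun _ : G => V ⧸ multiples V c) 1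
        (x.2 1 - Submodule.Quotient.mk (θ x.1)) h -
      reduceRep c ρ h (η (reduceRep c ρ h⁻¹ (x.2 1))) := rfl
  have hψ₀ : ∀ x ∈ Fiber G V c, ψ₀ x ∈ Fiber G V c := fun x _ => by
    obtain ⟨v, hv⟩ := Submodule.Quotient.mk_surjective _ (x.2 1)
    simp only [mem_fiber, hψ₁, hψ₂, Finset.sum_sub_distrib, ← hv, hη, hrmk]
    simp only [Submodule.Quotient.mk_sub, Finset.sum_pi_single', Finset.mem_univ, if_true]
    abel
  refine ⟨ψ₀.restrict hψ₀, LinearMap.ext fun x => ?_⟩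
  have hx := (mem_fiber c).1 x.2
  rw [← eq_neg_iff_add_eq_zero] at hx
  have hψ₁' (y : Fiber G V c) : (ψ₀.restrict hψ₀ y).1.1 = θ y.1.1 - r (y.1.2 1) := rfl
  have hψ₂' (y : Fiber G V c) (h : G) : (ψ₀.restrict hψ₀ y).1.2 h =
      Pi.single (M := fun _ : G => V ⧸ multiples V c) 1
        (y.1.2 1 - Submodule.Quotient.mk (θ y.1.1)) h -
      reduceRep c ρ h (η (reduceRep c ρ h⁻¹ (y.1.2 1))) := rfl
  rw [trace_apply, LinearMap.id_apply]
  refine fiber_ext c ?_ fun h => ?_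
  · have h1 := hrmk x.1.1
    rw [hx, map_neg, map_sum] at h1
    simp only [fiber_sum_fst, fiberRep_fst, hψ₁', fiberRep_snd, map_sub, Finset.sum_sub_distrib,
      inv_inv, mul_one, ← hre _ _, hr]
    rw [← trace_apply, sub_eq_add_neg, h1]
    abel
  · have hcollapse (g : G) : reduceRep c ρ g (reduceRep c ρ (g⁻¹ * h)
        (η (reduceRep c ρ (g⁻¹ * h)⁻¹ (reduceRep c ρ g⁻¹ (x.1.2 g))))) =
        reduceRep c ρ h (η (reduceRep c ρ h⁻¹ (x.1.2 g))) := by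
      simp only [← Module.End.mul_apply, ← map_mul]
      simp
    simp only [fiber_sum_snd, fiberRep_snd, hψ₂', fiberRep_fst, map_sub, Finset.sum_sub_distrib,
      inv_inv, mul_one, hcollapse]
    rw [← map_sum (reduceRep c ρ h), ← map_sum η, ← map_sum (reduceRep c ρ h⁻¹),
      ← neg_eq_iff_eq_neg.2 hx, Finset.sum_eq_single h]
    · simp only [inv_mul_cancel, Pi.single_eq_same, map_sub, hr, map_neg]
      have h2 : reduceRep c ρ h (Submodule.Quotient.mk (θ (ρ h⁻¹ x.1.1))) =
        reduceRep c ρ h (η (reduceRep c ρ h⁻¹ (Submodule.Quotient.mk x.1.1))) := rfl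
      rw [h2]
      abel
    · intro g _ hg
      rw [Pi.single_eq_of_ne (by rwa [ne_eq, inv_mul_eq_one]), map_zero]
    · simp

/-- The linear section `j` of the first projection commutes with `G` on `cV`, since its second
coordinate vanishes there. So on `cV` the trace of `fst ∘ ψ ∘ j` is computed from `trace ψ = id`. -/
lemma isTraceModulo_of_idIsTrace_fiberRep {ρ : Representation k G V}
    (h : IdIsTrace (fiberRep c ρ)) : IsTraceModulo c ρ := by
  classical
  obtain ⟨ψ, hψ⟩ := h
  let j : V →ₗ[k] Fiber G V c :=
    (LinearMap.prod LinearMap.id (-(LinearMap.single k (fun _ : G => V ⧸ multiples V c) 1 ∘ₗ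
      Submodule.mkQ _))).codRestrict (Fiber G V c)
      fun v => by simp [mem_fiber]
  refine ⟨LinearMap.fst k _ _ ∘ₗ Submodule.subtype _ ∘ₗ ψ ∘ₗ j, fun v => ?_⟩
  have hj (g : G) : j (ρ g⁻¹ (c • v)) = fiberRep c ρ g⁻¹ (j (c • v)) := by
    have h0 (w : V) : c • (Submodule.Quotient.mk w : V ⧸ multiples V c) = 0 :=
      (Submodule.Quotient.mk_eq_zero _).2 ⟨w, rfl⟩
    refine fiber_ext c rfl fun h => ?_
    rw [fiberRep_snd]
    simp [j, Pi.single_apply, apply_ite, h0]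
  have := congrArg (fun x : Fiber G V c => x.1.1) (LinearMap.congr_fun hψ (j (c • v)))
  rw [← map_smul, trace_apply]
  simp only [LinearMap.comp_apply, hj]
  rw [trace_apply, fiber_sum_fst] at this
  exact this.symm

lemma isTraceModulo_iff {ρ : Representation k G V} :
    IsTraceModulo c ρ ↔ IdIsTrace (fiberRep c ρ) :=
  ⟨IsTraceModulo.idIsTrace_fiberRep c, isTraceModulo_of_idIsTrace_fiberRep c⟩

end Fiber

end Trace

/-! ### Higman's criterion and morphisms in the stable category. -/

section Higman

variable {k : Type} [CommRing k] {G : Type u} [Group G] [Fintype G]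

lemma isEquivariant_hom {M N : Mod k G} (f : M ⟶ N) :
    IsEquivariant M.ρ N.ρ f.hom.toLinearMap :=
  fun g v => Rep.hom_comm_apply f g v

/-- The morphism given by an equivariant map. -/
def homOfEquivariant {M N : Mod k G} (f : M.V →ₗ[k] N.V) (hf : IsEquivariant M.ρ N.ρ f) : M ⟶ N :=
  Rep.ofHom (f.intertwiningMap_of_isIntertwiningMap _ _ hf)

@[simp] lemma homOfEquivariant_toLinearMap {M N : Mod k G} (f : M.V →ₗ[k] N.V)
    (hf : IsEquivariant M.ρ N.ρ f) : (homOfEquivariant f hf).hom.toLinearMap = f := rfl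

lemma hom_ext_linearMap {M N : Mod k G} {f g : M ⟶ N}
    (h : f.hom.toLinearMap = g.hom.toLinearMap) : f = g :=
  Rep.hom_ext (Representation.IntertwiningMap.ext h)

/-- The data of a `k`-split exact sequence of `kG`-modules. -/
lemma IsKSplitExact.splitSequence {S : ShortComplex (Mod k G)} (hS : IsKSplitExact S) :
    ∃ T : SplitSequence S.X₁.ρ S.X₂.ρ S.X₃.ρ,
      T.g = S.g.hom.toLinearMap := by
  obtain ⟨σ⟩ := hS
  exact ⟨{
    f := S.f.hom.toLinearMap
    g := S.g.hom.toLinearMap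
    r := σ.r.hom
    s := σ.s.hom
    f_equivariant := isEquivariant_hom _
    g_equivariant := isEquivariant_hom _
    r_f := congrArg ModuleCat.Hom.hom σ.f_r
    g_s := congrArg ModuleCat.Hom.hom σ.s_g
    g_f := congrArg (fun f => (Rep.Hom.hom f).toLinearMap) S.zero
    add_id := congrArg ModuleCat.Hom.hom σ.id }, rfl⟩

/-- With `s` a linear section of `g`, the lift is `trace (s φ ψ)`: applying `g` gives `trace (φ ψ) =
φ ∘ trace ψ = φ`. -/
lemma isWeaklyProjective_of_idIsTrace {P : Mod k G} (h : IdIsTrace P.ρ) :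
    IsWeaklyProjective P := by
  obtain ⟨ψ, hψ⟩ := h
  intro S hS φ
  obtain ⟨T, hg⟩ := hS.splitSequence
  refine ⟨homOfEquivariant (trace P.ρ S.X₂.ρ (T.s ∘ₗ φ.hom.toLinearMap ∘ₗ ψ))
    (isEquivariant_trace _ _ _), hom_ext_linearMap ?_⟩
  rw [Rep.hom_comp_toLinearMap, homOfEquivariant_toLinearMap, (isEquivariant_hom _).comp_trace,
    ← hg, ← LinearMap.comp_assoc, T.g_s, LinearMap.id_comp, ← (isEquivariant_hom _).comp_trace,
    hψ, LinearMap.comp_id]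

/-! ### Induced modules, on a copy `ι` of `G` in `Type`, where the modules live. -/

section Induced

variable {ι : Type} [Fintype ι] (e : G ≃ ι)

section

variable {V : Type*} [AddCommGroup V] [Module k V] (ρ : Representation k G V)

/-- The representation induced from the underlying module, as functions on a copy of `G` with
diagonal action. -/
def inducedRep : Representation k G (ι → V) where
  toFun g := LinearMap.pi fun i => ρ g ∘ₗ LinearMap.proj (e (g⁻¹ * e.symm i))
  map_one' := by ext; simp
  map_mul' g h := by ext; simp [mul_assoc]

lemma inducedRep_apply (g : G) (x : ι → V) (i : ι) :
    inducedRep e ρ g x i = ρ g (x (e (g⁻¹ * e.symm i))) := rfl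

variable (k ι V) in
/-- The canonical map from the induced representation. -/
def inducedSum : (ι → V) →ₗ[k] V := ∑ i, LinearMap.proj i

lemma inducedSum_apply (x : ι → V) : inducedSum k ι V x = ∑ i, x i := by
  simp [inducedSum]

lemma isEquivariant_inducedSum : IsEquivariant (inducedRep e ρ) ρ (inducedSum k ι V) :=
  fun g x => by
  rw [inducedSum_apply, inducedSum_apply, map_sum]
  exact Fintype.sum_equiv (e.symm.trans ((Equiv.mulLeft g⁻¹).trans e)) _ _ fun i => rfl

open Classical in
variable (k V) in
/-- The inclusion in the induced representation, as a linear map. -/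
def inducedSingle : V →ₗ[k] (ι → V) :=
  LinearMap.single k (fun _ : ι => V) (e 1)

lemma inducedSum_comp_single : inducedSum k ι V ∘ₗ inducedSingle k e V = LinearMap.id := by
  ext m
  rw [LinearMap.comp_apply, inducedSum_apply]
  simp [inducedSingle]

/-- The conjugates of the projection onto the coordinate of `1` are the projections onto all
coordinates, and these sum to the identity. -/
lemma idIsTrace_inducedRep : IdIsTrace (inducedRep e ρ) := by
  classical
  refine ⟨inducedSingle k e V ∘ₗ LinearMap.proj (e 1), LinearMap.ext fun x => funext fun i => ?_⟩
  rw [trace_apply, Finset.sum_apply, Finset.sum_eq_single (e.symm i)]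
  · simp only [inducedSingle, LinearMap.comp_apply, LinearMap.single_apply, inv_mul_cancel,
      Pi.single_eq_same, LinearMap.proj_apply, inducedRep_apply]
    rw [← Module.End.mul_apply, ← map_mul]
    simp
  · intro g _ hg
    simp only [inducedSingle, LinearMap.comp_apply, LinearMap.single_apply, inducedRep_apply]
    rw [Pi.single_eq_of_ne, map_zero]
    rw [ne_eq, e.apply_eq_iff_eq, inv_mul_eq_one]
    exact hg
  · simp

end

/-- The induced module `M↑G`. -/
abbrev induced (M : Mod k G) : Mod k G := Rep.of (inducedRep e M.ρ)

/-- The `k`-split exact sequence ending in `M↑G → M`. -/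
lemma exists_isKSplitExact_inducedSum (M : Mod k G) :
    ∃ (K : Mod k G) (f : K ⟶ induced e M) (w : f ≫
      homOfEquivariant (inducedSum k ι M.V) (isEquivariant_inducedSum e M.ρ) = 0),
      IsKSplitExact (ShortComplex.mk f _ w) := by
  let E := inducedSum k ι M.V
  have hE : E ∘ₗ inducedSingle k e M.V = LinearMap.id := inducedSum_comp_single e
  let K : Mod k G := Rep.of (X := LinearMap.ker E)
    { toFun := fun g => ((induced e M).ρ g).restrict fun x hx => by
        rw [LinearMap.mem_ker] at hx ⊢
        rw [isEquivariant_inducedSum e M.ρ g x, hx, map_zero]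
      map_one' := by ext; simp
      map_mul' := fun g h => by ext; simp }
  let f : K ⟶ induced e M := homOfEquivariant (LinearMap.ker E).subtype fun _ _ => rfl
  have w : f ≫ homOfEquivariant E (isEquivariant_inducedSum e M.ρ) = 0 :=
    hom_ext_linearMap (LinearMap.ext fun x => x.2)
  have hE' (m) : E (inducedSingle k e M.V m) = m := LinearMap.congr_fun hE m
  let r : (induced e M).V →ₗ[k] LinearMap.ker E :=
    (LinearMap.id - inducedSingle k e M.V ∘ₗ E).codRestrict _ fun x => by simp [hE']
  refine ⟨K, f, w, ⟨{
    r := ModuleCat.ofHom r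
    s := ModuleCat.ofHom (inducedSingle k e M.V)
    f_r := ModuleCat.hom_ext (LinearMap.ext fun x => Subtype.ext ?_)
    s_g := ModuleCat.hom_ext hE
    id := ModuleCat.hom_ext (LinearMap.ext fun x => ?_) }⟩⟩
  · change x.1 - inducedSingle k e M.V (E x.1) = x.1
    rw [LinearMap.mem_ker.1 x.2, map_zero, sub_zero]
  · exact sub_add_cancel x (inducedSingle k e M.V (E x))

end Induced

/-- Higman's criterion. -/
lemma IsWeaklyProjective.idIsTrace {P : Mod k G} (h : IsWeaklyProjective P) : IdIsTrace P.ρ := by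
  let e := Fintype.equivFin G
  obtain ⟨K, f, w, hS⟩ := exists_isKSplitExact_inducedSum e P
  -- Lifting the identity makes `P` an equivariant retract of `P↑G`, whose identity is a trace.
  obtain ⟨σ, hσ⟩ := h _ hS (𝟙 P)
  obtain ⟨ψ, hψ⟩ := idIsTrace_inducedRep e P.ρ
  refine ⟨inducedSum k _ P.V ∘ₗ ψ ∘ₗ σ.hom.toLinearMap, ?_⟩
  rw [← (isEquivariant_inducedSum e P.ρ).comp_trace, ← (isEquivariant_hom σ).trace_comp, hψ,
    LinearMap.id_comp]
  exact congrArg (fun f => (Rep.Hom.hom f).toLinearMap) hσ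

/-- The morphisms factoring through a weakly projective module are the traces. -/
lemma isPHom_iff {M N : Mod k G} {f : M ⟶ N} :
    IsPHom f ↔ ∃ θ, trace M.ρ N.ρ θ = f.hom.toLinearMap := by
  constructor
  · rintro ⟨P, a, b, hP, rfl⟩
    obtain ⟨ψ, hψ⟩ := hP.idIsTrace
    refine ⟨b.hom.toLinearMap ∘ₗ ψ ∘ₗ a.hom.toLinearMap, ?_⟩
    rw [← (isEquivariant_hom b).comp_trace, ← (isEquivariant_hom a).trace_comp, hψ,
      LinearMap.id_comp, Rep.hom_comp_toLinearMap]
  · rintro ⟨θ, hθ⟩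
    let e := Fintype.equivFin G
    -- A trace factors through `N↑G`: the equivariant sum `N↑G → N` moves inside the trace and
    -- cancels the linear inclusion.
    refine ⟨induced e N, homOfEquivariant (trace _ _ (inducedSingle k e N.V ∘ₗ θ))
      (isEquivariant_trace _ _ _), homOfEquivariant _ (isEquivariant_inducedSum e N.ρ),
      isWeaklyProjective_of_idIsTrace (idIsTrace_inducedRep e N.ρ), hom_ext_linearMap ?_⟩
    rw [Rep.hom_comp_toLinearMap, homOfEquivariant_toLinearMap, homOfEquivariant_toLinearMap,
      (isEquivariant_inducedSum e N.ρ).comp_trace, ← LinearMap.comp_assoc, inducedSum_comp_single,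
      LinearMap.id_comp, hθ]

lemma toStMod_map_eq_iff {M N : Mod k G} {f g : M ⟶ N} :
    (toStMod k G).map f = (toStMod k G).map g ↔ IsPHom (f - g) :=
  CategoryTheory.Quotient.functor_map_eq_iff (stableRel k G) f g

/-- Representatives of the stable retraction compose to the identity up to a stably zero map, that
is, up to a trace. -/
lemma exists_trace_of_retract {X Y : StMod k G} (h : Nonempty (Retract X Y)) :
    ∃ (f : X.as ⟶ Y.as) (g : Y.as ⟶ X.as) (φ : X.as.V →ₗ[k] X.as.V),
      ∀ x, g.hom (f.hom x) = x - trace X.as.ρ X.as.ρ φ x := by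
  obtain ⟨i, r, hir⟩ := h
  obtain ⟨f, rfl⟩ := (toStMod k G).map_surjective (X := X.as) (Y := Y.as) i
  obtain ⟨g, rfl⟩ := (toStMod k G).map_surjective (X := Y.as) (Y := X.as) r
  have h : (toStMod k G).map (𝟙 X.as) = (toStMod k G).map (f ≫ g) :=
    ((toStMod k G).map_id _).trans (hir.symm.trans ((toStMod k G).map_comp f g).symm)
  obtain ⟨φ, hφ⟩ := isPHom_iff.1 (toStMod_map_eq_iff.1 h)
  refine ⟨f, g, φ, fun x => ?_⟩
  rw [hφ]
  exact (sub_sub_cancel x _).symm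

end Higman

/-! ### Tensor products in the stable category. -/

section Tensor

variable {k : Type} [CommRing k] {G : Type u} [Group G] [Fintype G]

lemma trace_rTensor {V W X : Type*} [AddCommGroup V] [Module k V] [AddCommGroup W] [Module k W]
    [AddCommGroup X] [Module k X] (ρ : Representation k G V) (σ : Representation k G W)
    (τ : Representation k G X) (θ : V →ₗ[k] W) :
    trace (ρ.tprod τ) (σ.tprod τ) (θ.rTensor X) = (trace ρ σ θ).rTensor X := by
  refine TensorProduct.ext' fun v x => ?_
  simp [trace_apply, TensorProduct.sum_tmul, ← Module.End.mul_apply, ← map_mul]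

lemma trace_lTensor {V W X : Type*} [AddCommGroup V] [Module k V] [AddCommGroup W] [Module k W]
    [AddCommGroup X] [Module k X] (ρ : Representation k G V) (σ : Representation k G W)
    (τ : Representation k G X) (θ : V →ₗ[k] W) :
    trace (τ.tprod ρ) (τ.tprod σ) (θ.lTensor X) = (trace ρ σ θ).lTensor X := by
  refine TensorProduct.ext' fun v x => ?_
  simp [trace_apply, TensorProduct.tmul_sum, ← Module.End.mul_apply, ← map_mul]

open MonoidalCategory in
lemma IsPHom.whiskerRight {M N : Mod k G} {f : M ⟶ N} (hf : IsPHom f) (L : Mod k G) :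
    IsPHom (f ▷ L) := by
  obtain ⟨θ, hθ⟩ := isPHom_iff.1 hf
  refine isPHom_iff.2 ⟨θ.rTensor L.V, ?_⟩
  exact (trace_rTensor _ _ _ _).trans (by rw [hθ]; rfl)

open MonoidalCategory in
lemma IsPHom.whiskerLeft {M N : Mod k G} {f : M ⟶ N} (hf : IsPHom f) (L : Mod k G) :
    IsPHom (L ◁ f) := by
  obtain ⟨θ, hθ⟩ := isPHom_iff.1 hf
  refine isPHom_iff.2 ⟨θ.lTensor L.V, ?_⟩
  exact (trace_lTensor _ _ _ _).trans (by rw [hθ]; rfl)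

-- Tensoring with a fixed module preserves traces, so it descends to a functor on the stable
-- category; one variable is changed at a time.
open MonoidalCategory in
lemma tensor_stable_iso {M M' N N' : Mod k G}
    (e : (toStMod k G).obj M ≅ (toStMod k G).obj M')
    (e' : (toStMod k G).obj N ≅ (toStMod k G).obj N') :
    Nonempty ((toStMod k G).obj (M ⊗ N) ≅ (toStMod k G).obj (M' ⊗ N')) := by
  let F : StMod k G ⥤ StMod k G := CategoryTheory.Quotient.lift (stableRel k G)
    (tensorRight N ⋙ toStMod k G) fun A B f g h => by
      refine toStMod_map_eq_iff.2 ?_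
      have h' : IsPHom ((tensorRight N).map (f - g)) := IsPHom.whiskerRight h N
      rwa [Functor.map_sub] at h'
  let F' : StMod k G ⥤ StMod k G := CategoryTheory.Quotient.lift (stableRel k G)
    (tensorLeft M' ⋙ toStMod k G) fun A B f g h => by
      refine toStMod_map_eq_iff.2 ?_
      have h' : IsPHom ((tensorLeft M').map (f - g)) := IsPHom.whiskerLeft h M'
      rwa [Functor.map_sub] at h'
  exact ⟨F.mapIso e ≪≫ F'.mapIso e'⟩

end Tensor

/-! ### Modules on which `c` is `c` times a trace. -/

section Modulo

variable {k : Type} [CommRing k] {G : Type u} [Group G] [Fintype G] {c : k}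

/-- If `g f = id - trace φ` and `θ` works for `Y`, then `φ + g θ f` works for `X`. -/
lemma IsTraceModulo.of_retract {X Y : StMod k G} (hXY : Nonempty (Retract X Y))
    (hY : IsTraceModulo c Y.as.ρ) : IsTraceModulo c X.as.ρ := by
  obtain ⟨f, g, φ, hfg⟩ := exists_trace_of_retract hXY
  obtain ⟨θ, hθ⟩ := hY
  refine ⟨φ + g.hom.toLinearMap ∘ₗ θ ∘ₗ f.hom.toLinearMap, fun x => ?_⟩
  have h : c • g.hom (f.hom x) = c • g.hom (trace Y.as.ρ Y.as.ρ θ (f.hom x)) := by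
    rw [← map_smul, hθ, map_smul]
  rw [hfg, smul_sub, sub_eq_iff_eq_add'] at h
  rw [trace_add, ← (isEquivariant_hom g).comp_trace, ← (isEquivariant_hom f).trace_comp,
    LinearMap.add_apply, smul_add, h]
  rfl

lemma isTraceModulo_of_smul_eq_zero {V : Type*} [AddCommGroup V] [Module k V]
    {ρ : Representation k G V} (h : ∀ v : V, c • v = 0) : IsTraceModulo c ρ :=
  ⟨0, fun v => by rw [h, h]⟩

lemma IsTraceModulo.tprod {V W : Type*} [AddCommGroup V] [Module k V] [AddCommGroup W] [Module k W]
    {ρ : Representation k G V} (h : IsTraceModulo c ρ) (σ : Representation k G W) :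
    IsTraceModulo c (ρ.tprod σ) := by
  obtain ⟨θ, hθ⟩ := h
  refine ⟨θ.rTensor W, fun x => ?_⟩
  rw [trace_rTensor]
  induction x with
  | zero => simp
  | add x y hx hy => rw [smul_add, hx, hy, map_add, smul_add]
  | tmul v w => rw [LinearMap.rTensor_tmul, TensorProduct.smul_tmul', hθ, TensorProduct.smul_tmul']

lemma trace_reduce_mk {V W : Type*} [AddCommGroup V] [Module k V] [AddCommGroup W] [Module k W]
    (ρ : Representation k G V) (σ : Representation k G W) (θ : V →ₗ[k] W) (v : V) :
    trace (reduceRep c ρ) (reduceRep c σ) (reduce c θ) (Submodule.Quotient.mk v) =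
      Submodule.Quotient.mk (trace ρ σ θ v) := by
  rw [trace_apply, trace_apply, ← Submodule.mkQ_apply, ← Submodule.mkQ_apply, map_sum]
  rfl

/-- A module for which `c • id` agrees with `c • trace θ` is stably isomorphic to its reduction
modulo `c`. -/
lemma IsTraceModulo.iso_reduceRep {M : Mod k G} (h : IsTraceModulo c M.ρ) :
    Nonempty ((toStMod k G).obj M ≅ (toStMod k G).obj (Rep.of (reduceRep c M.ρ))) := by
  obtain ⟨θ, hθ⟩ := h
  let N : Mod k G := Rep.of (reduceRep c M.ρ)
  -- The hypothesis says that `id - trace θ` kills the multiples of `c`. Both composites of `r` with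
  -- the projection are the identity minus a trace.
  let r : N.V →ₗ[k] M.V := Submodule.liftQ _ (LinearMap.id - trace M.ρ M.ρ θ) (by
    rintro _ ⟨v, rfl⟩
    simpa [smul_sub, sub_eq_zero] using hθ v)
  let f : M ⟶ N := homOfEquivariant (Submodule.mkQ _) fun g v => rfl
  let g : N ⟶ M := homOfEquivariant r fun h w => by
    obtain ⟨v, rfl⟩ := Submodule.Quotient.mk_surjective _ w
    change M.ρ h v - trace M.ρ M.ρ θ (M.ρ h v) = M.ρ h (v - trace M.ρ M.ρ θ v)
    rw [map_sub, isEquivariant_trace M.ρ M.ρ θ h v]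
  have h₁ : IsPHom (f ≫ g - 𝟙 M) := isPHom_iff.2 ⟨-θ, by
    rw [trace_neg]
    ext x
    exact (sub_sub_cancel_left x (trace M.ρ M.ρ θ x)).symm⟩
  have h₂ : IsPHom (g ≫ f - 𝟙 N) := isPHom_iff.2 ⟨-reduce c θ, by
    refine LinearMap.ext fun w => ?_
    obtain ⟨v, rfl⟩ := Submodule.Quotient.mk_surjective _ w
    have h : trace N.ρ N.ρ (reduce c θ) (Submodule.Quotient.mk v) =
      Submodule.Quotient.mk (trace M.ρ M.ρ θ v) := trace_reduce_mk _ _ _ _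
    rw [trace_neg, LinearMap.neg_apply, h]
    exact (sub_sub_cancel_left (Submodule.Quotient.mk v)
      (Submodule.Quotient.mk (trace M.ρ M.ρ θ v))).symm⟩
  exact ⟨{
    hom := (toStMod k G).map f
    inv := (toStMod k G).map g
    hom_inv_id := by
      rw [← Functor.map_comp, toStMod_map_eq_iff.2 h₁, CategoryTheory.Functor.map_id]
    inv_hom_id := by
      rw [← Functor.map_comp, toStMod_map_eq_iff.2 h₂, CategoryTheory.Functor.map_id] }⟩

end Modulo

/-! ### Finite presentation over a noetherian base. -/

section FiniteGeneration

variable {k : Type} [CommRing k] {G : Type u} [Group G] [Finite G]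

instance : Module.Finite k (MonoidAlgebra k G) :=
  Module.Finite.of_basis (Module.Basis.ofRepr (MonoidAlgebra.coeffLinearEquiv k))

variable [IsNoetherianRing k]

lemma isFinPres_iff {M : Mod k G} : IsFinPres M ↔ Module.Finite k M.V := by
  have : IsNoetherianRing (MonoidAlgebra k G) := isNoetherian_of_tower k inferInstance
  constructor
  · intro h
    have : Module.FinitePresentation (MonoidAlgebra k G) M.ρ.asModule := h
    have : Module.Finite k M.ρ.asModule := Module.Finite.trans (MonoidAlgebra k G) _
    exact Module.Finite.equiv M.ρ.asModuleEquiv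
  · intro h
    have : Module.Finite (MonoidAlgebra k G) M.ρ.asModule :=
      Module.Finite.of_restrictScalars_finite k _ _
    exact Module.finitePresentation_of_finite _ _

lemma isFinPres_trivial (A : Type) [AddCommGroup A] [Module k A] [Module.Finite k A] :
    IsFinPres (Rep.trivial k G A) :=
  isFinPres_iff.2 ‹_›

lemma stmod_trivial (A : Type) [AddCommGroup A] [Module k A] [Module.Finite k A] :
    stmod k G ((toStMod k G).obj (Rep.trivial k G A)) :=
  ⟨_, isFinPres_trivial A, ⟨Iso.refl _⟩⟩

open MonoidalCategory in
lemma stmod_tensor {M N : Mod k G} (hM : stmod k G ((toStMod k G).obj M))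
    (hN : stmod k G ((toStMod k G).obj N)) : stmod k G ((toStMod k G).obj (M ⊗ N)) := by
  have := Fintype.ofFinite G
  obtain ⟨M', hM', ⟨e⟩⟩ := hM
  obtain ⟨N', hN', ⟨e'⟩⟩ := hN
  rw [isFinPres_iff] at hM' hN'
  exact ⟨M' ⊗ N', isFinPres_iff.2 (inferInstanceAs (Module.Finite k (TensorProduct k M'.V N'.V))),
    tensor_stable_iso e e'⟩

end FiniteGeneration

/-! ### The thick tensor ideal of modules annihilated by `c`. -/

section Annihilated

variable {k : Type} [CommRing k] {G : Type u} [Group G]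

lemma isTraceModulo_iff_exists_iso [Fintype G] {c : k} {X : StMod k G} :
    IsTraceModulo c X.as.ρ ↔
      ∃ N : Mod k G, (∀ x : N, c • x = 0) ∧ Nonempty (X ≅ (toStMod k G).obj N) := by
  constructor
  · refine fun h => ⟨_, fun x => ?_, h.iso_reduceRep⟩
    obtain ⟨v, rfl⟩ := Submodule.Quotient.mk_surjective _ x
    exact (Submodule.Quotient.mk_eq_zero _).2 ⟨v, rfl⟩
  · rintro ⟨N, hN, ⟨e⟩⟩
    exact IsTraceModulo.of_retract (Y := (toStMod k G).obj N) ⟨e.retract⟩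
      (isTraceModulo_of_smul_eq_zero hN)

/-- The objects of `stmod(kG)` isomorphic to modules annihilated by `c` form a thick tensor
ideal. -/
theorem isThickTensorIdeal_annihilated [IsNoetherianRing k] [Finite G] (c : k) :
    IsThickTensorIdeal (fun X : StMod k G => stmod k G X ∧
      ∃ N : Mod k G, (∀ x : N, c • x = 0) ∧ Nonempty (X ≅ (toStMod k G).obj N)) := by
  have := Fintype.ofFinite G
  simp_rw [← isTraceModulo_iff_exists_iso]
  refine
  { le_stmod := fun X h => h.1
    of_iso := ?_
    zero := ⟨stmod_trivial _, isTraceModulo_of_smul_eq_zero fun _ => rfl⟩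
    ext₁ := fun S hS hX h h' => ?_
    ext₂ := fun S hS hX h h' => ?_
    ext₃ := fun S hS hX h h' => ?_
    retract := fun X Y hX hXY hY => ⟨hX, IsTraceModulo.of_retract hXY hY.2⟩
    tensor := fun M N hM hN => ⟨stmod_tensor hM.1 hN, hM.2.tprod N.ρ⟩ }
  · rintro X Y ⟨e⟩ ⟨⟨M, hM, ⟨e'⟩⟩, h⟩
    exact ⟨⟨M, hM, ⟨e.symm ≪≫ e'⟩⟩, IsTraceModulo.of_retract ⟨e.symm.retract⟩ h⟩
  -- Triangles are handled on homotopy fibers, by two out of three for weak projectivity.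
  all_goals
    obtain ⟨T, -⟩ := hS.splitSequence
    rw [isTraceModulo_iff] at h h' ⊢
  · exact ⟨hX, (T.fiber _).idIsTrace₁ h.2 h'.2⟩
  · exact ⟨hX, (T.fiber _).idIsTrace₂ h.2 h'.2⟩
  · exact ⟨hX, (T.fiber _).idIsTrace₃ h.2 h'.2⟩

lemma trace_trivial [Fintype G] {V : Type*} [AddCommGroup V] [Module k V]
    (θ : V →ₗ[k] V) (v : V) :
    trace (Representation.trivial k G V) (Representation.trivial k G V) θ v =
      Nat.card G • θ v := by
  simp [trace_apply]

lemma IsTraceModulo.exists_smul_eq [Fintype G] {c : k} {A : Type} [AddCommGroup A] [Module k A]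
    (h : IsTraceModulo c (Rep.trivial k G A).ρ) (x : A) :
    ∃ a : A, c • x = c • (Nat.card G • a) := by
  obtain ⟨θ, hθ⟩ := h
  exact ⟨θ x, (hθ x).trans (congrArg (c • ·) (trace_trivial θ x))⟩

end Annihilated

/-! ### The chain `D_n` over `ℤ`. -/

section KilledBy

variable {G : Type u} [Group G] {p : ℕ}

/-- An object over `ℤ` carries its own scalar action `hV2` besides the integer multiples of its
additive group. The general results concern the former. -/
lemma killedBy_eq (n : ℕ) : killedBy G p n = fun X => stmod ℤ G X ∧
    ∃ N : Mod ℤ G, (∀ x : N, N.hV2.smul ((p : ℤ) ^ n) x = 0) ∧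
      Nonempty (X ≅ (toStMod ℤ G).obj N) := by
  ext X
  refine and_congr_right fun _ => exists_congr fun N => and_congr_left fun _ =>
    forall_congr' fun x => ?_
  rw [← int_smul_eq_zsmul N.hV2]

variable (G p) in
/-- The modules annihilated by `p ^ n` form a thick tensor ideal. -/
theorem isThickTensorIdeal_killedBy [Finite G] (n : ℕ) :
    IsThickTensorIdeal (killedBy G p n) := by
  rw [killedBy_eq]
  exact isThickTensorIdeal_annihilated _

lemma killedBy.exists_trace [Fintype G] {n : ℕ} {X : StMod ℤ G} (h : killedBy G p n X) :
    letI := X.as.hV2; IsTraceModulo ((p : ℤ) ^ n) X.as.ρ := by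
  rw [killedBy_eq] at h
  exact isTraceModulo_iff_exists_iso.2 h.2

lemma killedBy_mono {m n : ℕ} (h : m ≤ n) : killedBy G p m ≤ killedBy G p n := by
  rintro X ⟨hX, N, hN, e⟩
  refine ⟨hX, N, fun x => ?_, e⟩
  obtain ⟨d, rfl⟩ := Nat.exists_eq_add_of_le' h
  rw [pow_add, mul_smul, hN, smul_zero]

/-- The union of an increasing chain of thick subcategories is thick. -/
lemma isThick_iUnion {k : Type} [CommRing k] {C : ℕ → ObjectProperty (StMod k G)}
    (hC : ∀ n, 1 ≤ n → IsThick (C n)) (hmono : ∀ m n, m ≤ n → C m ≤ C n) :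
    IsThick (fun X => ∃ n, 1 ≤ n ∧ C n X) where
  le_stmod := fun X ⟨n, hn, h⟩ => (hC n hn).le_stmod X h
  of_iso := fun X Y e ⟨n, hn, h⟩ => ⟨n, hn, (hC n hn).of_iso X Y e h⟩
  zero := ⟨1, le_rfl, (hC 1 le_rfl).zero⟩
  ext₁ := fun S hS hX ⟨n, hn, h⟩ ⟨m, _, h'⟩ => ⟨max n m, hn.trans (le_max_left _ _),
    (hC _ (hn.trans (le_max_left _ _))).ext₁ S hS hX (hmono _ _ (le_max_left _ _) _ h)
      (hmono _ _ (le_max_right _ _) _ h')⟩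
  ext₂ := fun S hS hX ⟨n, hn, h⟩ ⟨m, _, h'⟩ => ⟨max n m, hn.trans (le_max_left _ _),
    (hC _ (hn.trans (le_max_left _ _))).ext₂ S hS hX (hmono _ _ (le_max_left _ _) _ h)
      (hmono _ _ (le_max_right _ _) _ h')⟩
  ext₃ := fun S hS hX ⟨n, hn, h⟩ ⟨m, _, h'⟩ => ⟨max n m, hn.trans (le_max_left _ _),
    (hC _ (hn.trans (le_max_left _ _))).ext₃ S hS hX (hmono _ _ (le_max_left _ _) _ h)
      (hmono _ _ (le_max_right _ _) _ h')⟩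
  retract := fun X Y hX hXY ⟨n, hn, h⟩ => ⟨n, hn, (hC n hn).retract X Y hX hXY h⟩

/-- If the trivial module `A` is stably isomorphic to a module annihilated by `p ^ n`, then
every multiple of `p ^ n` is a multiple of `p ^ n * |G|`. -/
lemma killedBy.exists_smul_eq [Finite G] {n : ℕ} {A : Type} [AddCommGroup A]
    (h : killedBy G p n ((toStMod ℤ G).obj (Rep.trivial ℤ G A))) (x : A) :
    ∃ a : A, (p ^ n) • x = (p ^ n) • (Nat.card G • a) := by
  have := Fintype.ofFinite G
  obtain ⟨a, ha⟩ := h.exists_trace.exists_smul_eq x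
  exact ⟨a, by simpa only [← natCast_zsmul, Nat.cast_pow] using ha⟩

lemma killedBy_zmod {m n : ℕ} (h : m ≤ n) [Finite G] (hp : p.Prime) :
    killedBy G p n ((toStMod ℤ G).obj (Rep.trivial ℤ G (ZMod (p ^ m)))) := by
  have : NeZero (p ^ m) := ⟨pow_ne_zero _ hp.ne_zero⟩
  refine ⟨stmod_trivial (ZMod (p ^ m)), _, fun x : ZMod (p ^ m) => ?_, ⟨Iso.refl _⟩⟩
  change ((p : ℤ) ^ n) • x = 0
  rw [zsmul_eq_mul, Int.cast_pow, Int.cast_natCast, ← Nat.cast_pow,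
    (ZMod.natCast_eq_zero_iff _ _).2 (pow_dvd_pow p h), zero_mul]

/-- From `p^n = p^n |G| a`, multiplication by `p^(m-n-1)` gives `p^(m-1) = 0` in `ℤ/p^m`, as `p`
divides `|G|`. -/
lemma not_killedBy_zmod [Finite G] (hp : p.Prime) (hpG : p ∣ Nat.card G) {m n : ℕ} (h : n < m) :
    ¬ killedBy G p n ((toStMod ℤ G).obj (Rep.trivial ℤ G (ZMod (p ^ m)))) := fun hk => by
  obtain ⟨a, ha⟩ := hk.exists_smul_eq (1 : ZMod (p ^ m))
  obtain ⟨d, rfl⟩ := Nat.exists_eq_add_of_lt h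
  obtain ⟨q, hq⟩ := hpG
  have h1 : ((p ^ (n + d) : ℕ) : ZMod (p ^ (n + d + 1))) = 0 := by
    rw [nsmul_eq_mul, nsmul_eq_mul, nsmul_eq_mul, mul_one, hq] at ha
    rw [show p ^ (n + d) = p ^ d * p ^ n by ring, Nat.cast_mul, ha, ← mul_assoc, ← mul_assoc,
      ← Nat.cast_mul, ← Nat.cast_mul, show p ^ d * p ^ n * (p * q) = p ^ (n + d + 1) * q by ring, Nat.cast_mul]
    simp
  rw [ZMod.natCast_eq_zero_iff, Nat.pow_dvd_pow_iff_le_right hp.one_lt] at h1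
  omega

lemma not_killedBy_int [Finite G] (hp : p.Prime) (hpG : p ∣ Nat.card G) {n : ℕ} :
    ¬ killedBy G p n ((toStMod ℤ G).obj (Rep.trivial ℤ G ℤ)) := fun hk => by
  obtain ⟨a, ha⟩ := hk.exists_smul_eq (1 : ℤ)
  obtain ⟨q, hq⟩ := hpG
  have hp' : (p ^ n : ℤ) ≠ 0 := pow_ne_zero _ (by exact_mod_cast hp.ne_zero)
  simp only [nsmul_eq_mul, hq] at ha
  push_cast at ha
  have h1 : (p : ℤ) * (q * a) = 1 := mul_left_cancel₀ hp' (by linear_combination -ha)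
  have := Int.isUnit_iff.1 (IsUnit.of_mul_eq_one _ h1)
  have := hp.one_lt
  omega

end KilledBy

/-! ### Alternating sums of faces. -/

section AlternatingSum

variable (k : Type*) [CommRing k] {G : Type*} {A : Type*} [AddCommGroup A] [Module k A]

/-- The alternating sum of the faces. -/
def altSum {n : ℕ} (F : (Fin n → G) → A) (x : Fin (n + 1) → G) : A :=
  ∑ i : Fin (n + 1), (-1 : k) ^ (i : ℕ) • F (fun j => x (i.succAbove j))

/-- Prepending `g` is the contracting homotopy of the standard complex; this identity drives both
`d² = 0` and the vanishing of traces on cohomology. -/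
lemma altSum_cons {n : ℕ} (F : (Fin (n + 1) → G) → A) (g : G) (y : Fin (n + 1) → G) :
    altSum k F (Fin.cons g y) = F y - altSum k (fun z => F (Fin.cons g z)) y := by
  rw [altSum, Fin.sum_univ_succ, altSum, sub_eq_add_neg, ← Finset.sum_neg_distrib]
  congr 1
  · simp
  · refine Finset.sum_congr rfl fun i _ => ?_
    have := Fin.cons_comp_succ_succAbove g y i
    rw [Fin.val_succ, pow_succ, mul_neg, mul_one, neg_smul]
    exact congrArg (fun z => -((-1 : k) ^ (i : ℕ) • F z)) this

lemma altSum_sub {n : ℕ} (F F' : (Fin n → G) → A) (x : Fin (n + 1) → G) :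
    altSum k (fun z => F z - F' z) x = altSum k F x - altSum k F' x := by
  simp [altSum, smul_sub, Finset.sum_sub_distrib]

lemma altSum_altSum {n : ℕ} (F : (Fin n → G) → A) (x : Fin (n + 2) → G) :
    altSum k (altSum k F) x = 0 := by
  induction n with
  | zero =>
    simp [altSum, Subsingleton.elim _ (default : Fin 0 → G)]
  | succ n ih =>
    rw [← Fin.cons_self_tail x, altSum_cons]
    simp only [altSum_cons]
    rw [altSum_sub, ih]
    simp

end AlternatingSum

/-! ### Supports and the scalars contained in their primes. -/

section Support

variable {k : Type} [CommRing k] {G : Type u} [Group G]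

lemma RelExt.mk_eq_zero {M N : Mod k G} {n : ℕ} {f : cocycles M N n} :
    RelExt.mk f = 0 ↔ f.1 ∈ coboundaries M N n :=
  Submodule.Quotient.mk_eq_zero _

lemma RelExt.mk_surjective {M N : Mod k G} {n : ℕ} (x : RelExt M N n) : ∃ f, RelExt.mk f = x :=
  Submodule.Quotient.mk_surjective _ x

lemma zeta_mk (M : Mod k G) {n : ℕ} (s : cocycles (unitMod k G) (unitMod k G) n) :
    zeta M (RelExt.mk s) = RelExt.mk (zetaCocycles M n s) := rfl

lemma RelExt.comp_mk {L M N : Mod k G} {a b : ℕ} (f : cocycles M N a) (g : cocycles L M b) :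
    RelExt.comp (RelExt.mk f) (RelExt.mk g) = RelExt.mk (cupCocycles L M N a b f g) := rfl

/-- The scalar `c` as a cocycle of degree zero. -/
def scalarCocycle (M : Mod k G) (c : k) : cocycles M M 0 :=
  ⟨.mk (fun _ => c • LinearMap.id) fun h x => by ext m; simp, by
    rw [cocycles, LinearMap.mem_ker]
    ext x m
    simp [diff_apply, Fin.sum_univ_two]
    rfl⟩

variable (G) in
/-- The scalar `c` as an element of `H^0(G, k)`. -/
def scalarClass (c : k) : Coh k G 0 := RelExt.mk (scalarCocycle _ c)

lemma RelExt.comp_scalarCocycle {M N : Mod k G} {n : ℕ} (x : RelExt M N n) (c : k) :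
    RelExt.comp x (RelExt.mk (scalarCocycle M c)) = c • x := by
  obtain ⟨f, rfl⟩ := RelExt.mk_surjective x
  rw [RelExt.comp_mk, ← map_smul]
  refine congrArg RelExt.mk (Subtype.ext (Cochain.ext fun x m => ?_))
  exact map_smul (f.1.val x) c m

lemma comp_scalarClass {n : ℕ} (s : Coh k G n) (c : k) :
    RelExt.comp s (scalarClass G c) = c • s :=
  RelExt.comp_scalarCocycle s c

lemma scalarClass_mul (c d : k) :
    RelExt.comp (scalarClass G c) (scalarClass G d) = scalarClass G (c * d) := by
  rw [comp_scalarClass, scalarClass, ← map_smul]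
  refine congrArg RelExt.mk (Subtype.ext (Cochain.ext fun x m => ?_))
  change d * (c * m) = (c * d) * m
  ring

namespace CohSpec

variable (𝔭 : CohSpec k G)

lemma smul_mem_of_scalarClass_mem {c : k} (hc : scalarClass G c ∈ 𝔭.piece 0) {n : ℕ}
    (s : Coh k G n) : c • s ∈ 𝔭.piece n := by
  rw [← comp_scalarClass]
  exact 𝔭.mul_mem_left s _ hc

lemma scalarClass_mem_of_pow {c : k} {n : ℕ} (h : scalarClass G (c ^ n) ∈ 𝔭.piece 0) :
    scalarClass G c ∈ 𝔭.piece 0 := by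
  induction n with
  | zero =>
    have := 𝔭.smul_mem_of_scalarClass_mem h (scalarClass G c)
    rwa [pow_zero, one_smul] at this
  | succ n ih =>
    rw [pow_succ, ← scalarClass_mul] at h
    exact (𝔭.mem_or_mem _ _ h).elim ih id

end CohSpec

lemma diff_val {M N : Mod k G} {n : ℕ} (f : Cochain M N n) :
    (diff M N n f).val = altSum k f.val := rfl

lemma coboundaries_le_cocycles (M N : Mod k G) (n : ℕ) : coboundaries M N n ≤ cocycles M N n := by
  cases n with
  | zero => exact bot_le
  | succ n =>
    rintro _ ⟨e, rfl⟩
    rw [cocycles, LinearMap.mem_ker]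
    refine Cochain.ext fun x m => ?_
    rw [diff_val, diff_val, altSum_altSum]
    rfl

/-- Composition with a trace is zero on `Ext` in positive degrees. -/
lemma trace_comp_mem_coboundaries [Fintype G] {M N : Mod k G} {n : ℕ} (θ : N.V →ₗ[k] N.V)
    (f : Cochain M N (n + 1)) (hf : f ∈ cocycles M N (n + 1)) (g : Cochain M N (n + 1))
    (hg : ∀ x m, g.val x m = trace N.ρ N.ρ θ (f.val x m)) : g ∈ coboundaries M N (n + 1) := by
  -- The contraction `f ↦ f(h, -)` is not equivariant in `h`; weighting it by `h θ h⁻¹` and summing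
  -- over `h` makes it so.
  refine ⟨.mk (fun x => ∑ h, (N.ρ h ∘ₗ θ ∘ₗ N.ρ h⁻¹) ∘ₗ f.val (Fin.cons h x)) fun u x => ?_, ?_⟩
  · have hcons (h : G) : (Fin.cons (u * h) fun i => u * x i : Fin (n + 2) → G) =
        fun i => u * (Fin.cons h x : Fin (n + 2) → G) i :=
      by
      funext i
      cases i using Fin.cases <;> simp
    ext m
    simp only [LinearMap.comp_apply, LinearMap.sum_apply, map_sum]
    refine (Fintype.sum_equiv (Equiv.mulLeft u) _ _ fun h => ?_).symm
    have := LinearMap.congr_fun (f.prop u (Fin.cons h x)) m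
    simp only [LinearMap.comp_apply] at this
    have hu (w : N) : N.ρ (h⁻¹ * u⁻¹) (N.ρ u w) = N.ρ h⁻¹ w := by
      rw [← Module.End.mul_apply, ← map_mul, inv_mul_cancel_right]
    rw [Equiv.coe_mulLeft, hcons, this, mul_inv_rev, hu, map_mul]
    rfl
  · refine Cochain.ext fun x m => ?_
    -- For a cocycle, each `f(h, -)` has differential `f`, whatever `h` is.
    have hf' (h : G) : altSum k (fun z => f.val (Fin.cons h z)) x = f.val x := by
      have := congrArg (fun f => f.val (Fin.cons h x)) (LinearMap.mem_ker.1 hf)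
      simp only [diff_val, altSum_cons] at this
      exact (sub_eq_zero.1 this).symm
    have h (T : G → N.V →ₗ[k] N.V) :
        altSum k (fun z => ∑ h, T h ∘ₗ f.val (Fin.cons h z)) x m =
          ∑ h, T h (altSum k (fun z => f.val (Fin.cons h z)) x m) := by
      simp only [altSum, Finset.smul_sum, LinearMap.sum_apply, LinearMap.smul_apply, map_sum,
        map_smul, LinearMap.comp_apply]
      exact Finset.sum_comm
    rw [hg, trace_apply, diff_val]
    refine (h fun h => N.ρ h ∘ₗ θ ∘ₗ N.ρ h⁻¹).trans (Finset.sum_congr rfl fun h _ => ?_)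
    rw [hf']
    rfl

lemma smul_eq_zero_of_isTraceModulo [Fintype G] {M : Mod k G} {c : k} (h : IsTraceModulo c M.ρ)
    {n : ℕ} (x : RelExt M M (n + 1)) : c • x = 0 := by
  obtain ⟨θ, hθ⟩ := h
  obtain ⟨f, rfl⟩ := RelExt.mk_surjective x
  rw [← map_smul, RelExt.mk_eq_zero]
  exact trace_comp_mem_coboundaries θ _ (c • f).2 _ fun x m =>
    (hθ _).trans (map_smul (trace M.ρ M.ρ θ) c (f.1.val x m)).symm

/-- The support of a module on which a power of `c` is a trace lies over the locus `c = 0`. -/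
lemma scalarClass_mem_of_mem_supp [Fintype G] {M : Mod k G} {c : k} {n : ℕ}
    (h : IsTraceModulo (c ^ n) M.ρ) {𝔭 : CohSpec k G} (h𝔭 : 𝔭 ∈ supp M) :
    scalarClass G c ∈ 𝔭.piece 0 := by
  obtain ⟨b, x, hx⟩ := h𝔭
  by_contra hc
  -- A class of positive degree outside `𝔭` is needed, since traces vanish only in positive degrees.
  -- If `c ∉ 𝔭`, then `c ^ n • s` lies outside `𝔭` and acts as zero.
  obtain ⟨m, hm, s, hs⟩ := 𝔭.not_irrelevant
  obtain ⟨m, rfl⟩ := Nat.exists_eq_add_of_le' hm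
  refine hx _ (c ^ n • s) (fun h' => ?_) ?_
  · rw [← comp_scalarClass] at h'
    exact (𝔭.mem_or_mem _ _ h').elim hs fun h' => hc (𝔭.scalarClass_mem_of_pow h')
  · rw [map_smul, smul_eq_zero_of_isTraceModulo h, map_zero, LinearMap.zero_apply]

/-- A prime containing all classes that vanish on `M` lies in the support of `M`. -/
lemma mem_supp_of_zeta {M : Mod k G} {𝔭 : CohSpec k G}
    (h : ∀ (n : ℕ) (s : Coh k G n), zeta M s = 0 → s ∈ 𝔭.piece n) : 𝔭 ∈ supp M := by
  -- The identity of `M`, on which `s` acts with result `zeta M s`.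
  refine ⟨0, RelExt.mk (scalarCocycle M 1), fun n s hs h0 => hs (h n s ?_)⟩
  rwa [RelExt.comp_scalarCocycle, one_smul] at h0

end Support

/-! ### The support of `ℤ/p^n`. -/

section ZMod

variable {G : Type u} [Group G]

variable {N : ℕ} {n : ℕ}

/-- A cochain with values in `ℤ` that vanishes modulo `N` is a multiple of `N`. -/
lemma exists_of_zetaCochain_eq_zero {s : Cochain (unitMod ℤ G) (unitMod ℤ G) n}
    (hs : zetaCochain (Rep.trivial ℤ G (ZMod N)) n s = 0) :
    ∃ t : Cochain (unitMod ℤ G) (unitMod ℤ G) n, s = (N : ℤ) • t := by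
  have hdvd (x : Fin (n + 1) → G) : (N : ℤ) ∣ (s.val x (1 : ℤ) : ℤ) := by
    rw [← ZMod.intCast_zmod_eq_zero_iff_dvd]
    have h : (s.val x (1 : ℤ) : ℤ) • (1 : ZMod N) = 0 :=
      congrArg (fun f => f.val x (1 : ZMod N)) hs
    rwa [zsmul_eq_mul, mul_one] at h
  refine ⟨.mk (fun x => ((s.val x (1 : ℤ) : ℤ) / N) • LinearMap.id) fun h x => ?_, ?_⟩
  · have hs : s.val (fun i => h * x i) (1 : ℤ) = s.val x (1 : ℤ) :=
      LinearMap.congr_fun (s.prop h x) 1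
    rw [hs]
    rfl
  · refine Cochain.ext fun x (m : ℤ) => ?_
    have h : s.val x m = m • s.val x (1 : ℤ) := by
      rw [← map_smul, smul_eq_mul, mul_one]
    rw [h]
    change m * (s.val x (1 : ℤ) : ℤ) = N * ((s.val x (1 : ℤ) : ℤ) / N * m)
    rw [← mul_assoc, Int.mul_ediv_cancel' (hdvd x), mul_comm]

/-- Every cochain with values in `End(ℤ/N) = ℤ/N` lifts to one with values in `ℤ`. -/
lemma zetaCochain_surjective : Function.Surjective (zetaCochain (Rep.trivial ℤ G (ZMod N)) n) := by
  intro e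
  -- Any set-theoretic lift `ℤ/N → ℤ` will do: the actions are trivial, so equivariance is
  -- invariance under translation of `x`.
  refine ⟨.mk (fun x => ((e.val x (1 : ZMod N) : ZMod N).cast : ℤ) • LinearMap.id)
    fun h x => ?_, Cochain.ext fun x m => ?_⟩
  · have he : e.val (fun i => h * x i) (1 : ZMod N) = e.val x (1 : ZMod N) :=
      LinearMap.congr_fun (e.prop h x) (1 : ZMod N)
    rw [he]
    rfl
  · change ZMod N at m
    have h : e.val x m = (m.cast : ℤ) • e.val x (1 : ZMod N) := by
      rw [← map_smul, zsmul_eq_mul, ZMod.intCast_zmod_cast, mul_one]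
    rw [h]
    change ((e.val x (1 : ZMod N) : ZMod N).cast * 1 : ℤ) • m =
      (m.cast : ℤ) • (e.val x (1 : ZMod N) : ZMod N)
    rw [zsmul_eq_mul, zsmul_eq_mul, mul_one, ZMod.intCast_zmod_cast, ZMod.intCast_zmod_cast,
      mul_comm]

/-- The kernel of `H^*(G, ℤ) → H^*(G, ℤ/N)` consists of the multiples of `N`. -/
lemma exists_smul_eq_of_zeta_eq_zero (hN : N ≠ 0) {s : Coh ℤ G n}
    (hs : zeta (Rep.trivial ℤ G (ZMod N)) s = 0) : ∃ t : Coh ℤ G n, s = (N : ℤ) • t := by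
  obtain ⟨f, rfl⟩ := RelExt.mk_surjective s
  rw [zeta_mk, RelExt.mk_eq_zero] at hs
  -- Lifting the bounding cochain from `ℤ/N` to `ℤ` alters `f` by a coboundary so that it vanishes
  -- modulo `N` as a cochain.
  obtain ⟨e, he, t, ht⟩ : ∃ e ∈ coboundaries (unitMod ℤ G) (unitMod ℤ G) n,
      ∃ t : Cochain (unitMod ℤ G) (unitMod ℤ G) n, f.1 - e = (N : ℤ) • t := by
    cases n with
    | zero =>
      refine ⟨0, zero_mem _, ?_⟩
      rw [sub_zero]
      exact exists_of_zetaCochain_eq_zero ((Submodule.mem_bot ℤ).1 hs)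
    | succ n =>
      obtain ⟨e, he⟩ := hs
      obtain ⟨e, rfl⟩ := zetaCochain_surjective e
      refine ⟨diff _ _ _ e, ⟨e, rfl⟩, exists_of_zetaCochain_eq_zero ?_⟩
      rw [map_sub, ← diff_zetaCochain, he]
      exact sub_self _
  have hd : (N : ℤ) • diff _ _ n t = 0 := by
    rw [← map_smul, ← ht, map_sub, LinearMap.mem_ker.1 f.2,
      LinearMap.mem_ker.1 (coboundaries_le_cocycles _ _ _ he), sub_zero]
  -- Integral cochains have no `N`-torsion, so the quotient `t` is itself a cocycle.
  have hdt : diff _ _ n t = 0 := Cochain.ext fun x m => by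
    have := congrArg (fun f => f.val x m) hd
    exact (mul_eq_zero.1 this).resolve_left (Nat.cast_ne_zero.2 hN)
  refine ⟨RelExt.mk ⟨t, hdt⟩, ?_⟩
  rw [← sub_eq_zero, ← map_smul, ← map_sub, RelExt.mk_eq_zero]
  change f.1 - (N : ℤ) • t ∈ _
  rwa [← ht, sub_sub_cancel]

/-- If `p ∈ 𝔭` then `𝔭` is in the support of `ℤ/p^n`. -/
lemma mem_supp_zmod {p n : ℕ} (hp : p.Prime) (hn : 1 ≤ n) {𝔭 : CohSpec ℤ G}
    (h : scalarClass G (p : ℤ) ∈ 𝔭.piece 0) : 𝔭 ∈ supp (Rep.trivial ℤ G (ZMod (p ^ n))) := by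
  refine mem_supp_of_zeta fun m s hs => ?_
  obtain ⟨t, rfl⟩ := exists_smul_eq_of_zeta_eq_zero (pow_ne_zero n hp.ne_zero) hs
  obtain ⟨n, rfl⟩ := Nat.exists_eq_add_of_le' hn
  rw [pow_succ', Nat.cast_mul, mul_smul]
  exact 𝔭.smul_mem_of_scalarClass_mem h _

lemma killedBy.scalarClass_mem [Finite G] {p n : ℕ} {M : Mod ℤ G}
    (h : killedBy G p n ((toStMod ℤ G).obj M)) {𝔭 : CohSpec ℤ G} (h𝔭 : 𝔭 ∈ supp M) :
    scalarClass G (p : ℤ) ∈ 𝔭.piece 0 := by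
  have := Fintype.ofFinite G
  exact scalarClass_mem_of_mem_supp h.exists_trace h𝔭

/-- The description by `p ∈ 𝔭` is independent of `n`, which is why all these supports coincide. -/
lemma supp_zmod [Finite G] {p n : ℕ} (hp : p.Prime) (hn : 1 ≤ n) :
    supp (k := ℤ) (Rep.trivial ℤ G (ZMod (p ^ n))) =
      {𝔭 | scalarClass G (p : ℤ) ∈ 𝔭.piece 0} := by
  ext 𝔭
  exact ⟨(killedBy_zmod le_rfl hp).scalarClass_mem, mem_supp_zmod hp hn⟩

end ZMod

end StableRep

end

/-! ### The chain, its union and the failure of classification. -/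

theorem mainTheorem5 {G : Type u} [Group G] [Finite G] (p : ℕ) (hp : p.Prime)
    (hpG : p ∣ Nat.card G) :
    -- each `D_n` is a thick tensor ideal, and the chain is strictly increasing
    (∀ n : ℕ, 1 ≤ n → StableRep.IsThickTensorIdeal (StableRep.killedBy G p n)) ∧
    (∀ n : ℕ, 1 ≤ n → StableRep.killedBy G p n < StableRep.killedBy G p (n + 1)) ∧
    -- the trivial module `ℤ` lies in `stmod(ℤG)` but in no `D_n`
    StableRep.stmod ℤ G ((StableRep.toStMod ℤ G).obj (Rep.trivial ℤ G ℤ)) ∧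
    (∀ n : ℕ, 1 ≤ n →
      ¬ StableRep.killedBy G p n ((StableRep.toStMod ℤ G).obj (Rep.trivial ℤ G ℤ))) ∧
    -- the union of the `D_n` is a proper thick subcategory
    (StableRep.IsThick (k := ℤ) (G := G) (fun X => ∃ n : ℕ, 1 ≤ n ∧ StableRep.killedBy G p n X) ∧
      (fun X => ∃ n : ℕ, 1 ≤ n ∧ StableRep.killedBy G p n X) < StableRep.stmod ℤ G) ∧
    -- thick tensor ideals of `stmod(ℤG)` are not classified by their supports: `ℤ/p^n` is not in
    -- the thick tensor ideal generated by `ℤ/p`, although the supports of these modules agree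
    (∀ n : ℕ, 1 < n → ¬ StableRep.thickTensorIdealGeneratedBy
      ((StableRep.toStMod ℤ G).obj (Rep.trivial ℤ G (ZMod p)))
      ((StableRep.toStMod ℤ G).obj (Rep.trivial ℤ G (ZMod (p ^ n))))) ∧
    (∀ n : ℕ, 1 ≤ n → StableRep.supp (k := ℤ) (Rep.trivial ℤ G (ZMod (p ^ n))) =
      StableRep.supp (k := ℤ) (Rep.trivial ℤ G (ZMod p))) ∧
    ¬ Function.Injective (StableRep.suppMap ℤ G) := by
  have hthick := StableRep.isThickTensorIdeal_killedBy G p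
  refine ⟨fun n _ => hthick n,
    fun n _ => lt_of_le_not_ge (StableRep.killedBy_mono n.le_succ) fun h =>
      StableRep.not_killedBy_zmod hp hpG n.lt_succ_self (h _ (StableRep.killedBy_zmod le_rfl hp)),
    StableRep.stmod_trivial ℤ, fun n _ => StableRep.not_killedBy_int hp hpG,
    ⟨StableRep.isThick_iUnion (fun n _ => (hthick n).toIsThick)
      fun _ _ => StableRep.killedBy_mono, lt_of_le_not_ge ?_ fun h => ?_⟩,
    fun n hn h => ?_, fun n hn => ?_, fun hinj => ?_⟩
  · rintro X ⟨n, -, hX⟩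
    exact hX.1
  · obtain ⟨n, -, hn⟩ := h _ (StableRep.stmod_trivial ℤ)
    exact StableRep.not_killedBy_int hp hpG hn
  -- `D_1` is itself a thick tensor ideal containing `ℤ/p`, and it omits `ℤ/p^n`.
  · have h1 := StableRep.killedBy_zmod (G := G) (m := 1) (n := 1) le_rfl hp
    rw [pow_one] at h1
    exact StableRep.not_killedBy_zmod hp hpG hn (h _ (hthick 1) h1)
  · rw [StableRep.supp_zmod hp hn, ← StableRep.supp_zmod hp le_rfl, pow_one]
  -- `D_1` and `D_2` have the same image: a prime supporting a module of `D_2` contains `p`, hence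
  -- already supports `ℤ/p`, which lies in `D_1`.
  · have h := hinj (a₁ := ⟨_, hthick 1⟩) (a₂ := ⟨_, hthick 2⟩) <| Subtype.ext <| Set.ext fun 𝔭 =>
      ⟨fun ⟨M, hM, h, h𝔭⟩ => ⟨M, hM, StableRep.killedBy_mono one_le_two _ h, h𝔭⟩,
        fun ⟨M, _, h, h𝔭⟩ => ⟨Rep.trivial ℤ G (ZMod (p ^ 1)), ?_,
          StableRep.killedBy_zmod le_rfl hp,
          StableRep.mem_supp_zmod hp le_rfl (StableRep.killedBy.scalarClass_mem h h𝔭)⟩⟩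
    · exact StableRep.not_killedBy_zmod hp hpG one_lt_two
        ((congrFun (congrArg Subtype.val h) _).mpr (StableRep.killedBy_zmod le_rfl hp))
    · have : NeZero (p ^ 1) := ⟨pow_ne_zero _ hp.ne_zero⟩
      exact StableRep.isFinPres_trivial (ZMod (p ^ 1))
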